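/- A knot (a knot diagram on the sphere, up to Reidemeister moves) is called \emph{bipartite} if it has a \emph{matched diagram}, that is, a diagram whose set of crossings can be split into disjoint pairs such that the two crossings of each pair form a full twist of two counter-directed strands: one strand runs through the first crossing and then directly through the second, the other strand runs through the second and then directly through the first, each strand is once the upper and once the lower one, and both crossings have the same sign. For a diagram $D$ of a knot $K$ let $A$ be its Alexander matrix over $\mathbb{Z}[t,t^{-1}]$ (obtained by Fox calculus from the Wirtinger presentation of the knot group, with one column deleted; it presents the first homology of the infinite cyclic cover of the knot complement). The $m$-th Alexander ideal $I_m(K)\subseteq\mathbb{Z}[t,t^{-1}]$ is the ideal generated by all minors of $A$ of size $n-m+1$, where $n$ is the smaller one of the numbers of rows and columns of $A$ (the whole ring if $n-m+1\le 0$). \textbf{Theorem.} (a) Let $K$ be a bipartite knot and $m\ge 0$. If the Alexander ideal $I_m(K)$, computed from any diagram of $K$, is non-trivial, i.e. $I_m(K)\neq\mathbb{Z}[t,t^{-1}]$, then $1+t\notin I_m(K)$. (Equivalently, a knot with a non-trivial Alexander ideal that contains $1+t$ has no matched diagram.) (b) There exist knots that are not bipartite, i.e. that have no matched diagram (Przytycki's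 conjecture, part of Problem 1.60 in Kirby's list). -/

import Mathlib

/-!
Oriented knot diagrams on the sphere are encoded by signed Gauss words: one runs once along the
knot and records every passage through a crossing.  A signed Gauss word determines the cyclic
order of the four half-edges at each crossing, hence a cellular decomposition of a closed oriented
surface; the word is a knot diagram on the sphere exactly if this surface has Euler
characteristic 2.  Knots are knot diagrams up to Reidemeister moves.
-/

open scoped LaurentPolynomial

namespace BipartiteKnots

/-- One passage of the knot through a crossing: the name of the crossing, whether the passage is
the upper one, and whether the crossing is positive. -/
@[ext]
structure Letter where
  label : ℕ
  isOver : Bool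
  isPos : Bool
  deriving DecidableEq

/-- The other passage through the same crossing. -/
def Letter.mate (x : Letter) : Letter := ⟨x.label, !x.isOver, x.isPos⟩

/-- Renaming of a crossing. -/
def Letter.relabel (f : ℕ → ℕ) (x : Letter) : Letter := ⟨f x.label, x.isOver, x.isPos⟩

/-- Signed Gauss words: every crossing that occurs is passed exactly twice, once above and once
below, and its two passages carry the same sign. The word is read cyclically. -/
structure IsGaussWord (w : List Letter) : Prop where
  nodup : w.Nodup
  mate_mem : ∀ x ∈ w, x.mate ∈ w
  eq_or_eq_mate : ∀ x ∈ w, ∀ y ∈ w, y.label = x.label → y = x ∨ y = x.mate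

/-- `i` and `k` are the two passages through one crossing. -/
def Meets (w : List Letter) (i k : Fin w.length) : Prop :=
  i ≠ k ∧ (w.get i).label = (w.get k).label

instance (w : List Letter) (i k : Fin w.length) : Decidable (Meets w i k) :=
  inferInstanceAs (Decidable (_ ∧ _))

/-- The strand met at the passage `i` crosses from the right to the left. (A crossing is positive
if the upper strand is turned counterclockwise into the lower one.) -/
def FromRight (w : List Letter) (i : Fin w.length) : Prop :=
  (w.get i).isOver = (w.get i).isPos

/-- The edges of the diagram are numbered by `Fin w.length`: the edge `i` leads from the passage
`i` to the passage `finRotate _ i` that follows it cyclically. A dart `(i, b)` is the edge `i`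
traversed forwards (`b = true`) or backwards (`b = false`). `FaceStep w d d'` says that a traveller
along `d` who turns left at the crossing at the end of `d` continues along `d'`. -/
inductive FaceStep (w : List Letter) : Fin w.length × Bool → Fin w.length × Bool → Prop
  | fwd_fwd (i k : Fin w.length) : Meets w (finRotate _ i) k → FromRight w (finRotate _ i) →
      FaceStep w (i, true) (k, true)
  | fwd_bwd (i e : Fin w.length) : Meets w (finRotate _ i) (finRotate _ e) →
      ¬ FromRight w (finRotate _ i) → FaceStep w (i, true) (e, false)
  | bwd_bwd (i e : Fin w.length) : Meets w i (finRotate _ e) → FromRight w i →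
      FaceStep w (i, false) (e, false)
  | bwd_fwd (i k : Fin w.length) : Meets w i k → ¬ FromRight w i →
      FaceStep w (i, false) (k, true)

/-- The faces (complementary regions) of the diagram: darts that have the same region on their
left are identified. -/
def Face (w : List Letter) : Type := Quot (FaceStep w)

/-- The diagram lies on the sphere: it is the circle without crossings, or `V - E + F = 2`, where
`V = w.length / 2` and `E = w.length`. -/
def IsSpherical (w : List Letter) : Prop :=
  w = [] ∨ 2 * Nat.card (Face w) = w.length + 4

/-- Oriented knot diagrams. -/
structure KnotDiagram where
  word : List Letter
  isGaussWord : IsGaussWord word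
  isSpherical : IsSpherical word

/-- The letters `x`, `y` in this order or in the opposite one. -/
def ordered (b : Bool) (x y : Letter) : List Letter := if b then [x, y] else [y, x]

/-- The elementary changes of a Gauss word: choice of another starting point, renaming of the
crossings, and the three Reidemeister moves with all orientations of the strands. -/
inductive ReidemeisterStep : List Letter → List Letter → Prop
  | rotate (u v : List Letter) : ReidemeisterStep (u ++ v) (v ++ u)
  | relabel (f : ℕ → ℕ) (hf : Function.Injective f) (w : List Letter) :
      ReidemeisterStep w (w.map (Letter.relabel f))
  /-- A kink is added. -/
  | r1 (a : ℕ) (o s : Bool) (w : List Letter) :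
      ReidemeisterStep w ([⟨a, o, s⟩, ⟨a, !o, s⟩] ++ w)
  /-- A piece of the knot is pushed over another one; `d` tells whether they are parallel. -/
  | r2 (a b : ℕ) (s d : Bool) (u v : List Letter) :
      ReidemeisterStep (u ++ v)
        ([⟨a, true, s⟩, ⟨b, true, !s⟩] ++ u ++
          ordered d ⟨a, false, s⟩ ⟨b, false, !s⟩ ++ v)
  /-- Three strands bound a triangle, and one of them is moved across the crossing of the other
  two. The top strand meets the middle one in `a` and the bottom one in `b`, and the middle
  strand meets the bottom one in `c`; `α`, `β`, `γ` are the orders in which the top, middle and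
  bottom strand pass through their two crossings. The hypotheses on `α`, `β`, `γ` and the signs
  say that the strands are placed like three oriented straight lines in the plane. Here the
  strands follow one another along the knot as top, middle, bottom. -/
  | r3 (a b c : ℕ) (sa sb sc α β γ : Bool) (u v w : List Letter)
      (hβ : (α = β) ↔ (sb = sc)) (hγ : (α = γ) ↔ (sa = sc)) :
      ReidemeisterStep
        (ordered α ⟨a, true, sa⟩ ⟨b, true, sb⟩ ++ u ++
          ordered β ⟨a, false, sa⟩ ⟨c, true, sc⟩ ++ v ++
          ordered γ ⟨b, false, sb⟩ ⟨c, false, sc⟩ ++ w)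
        (ordered (!α) ⟨a, true, sa⟩ ⟨b, true, sb⟩ ++ u ++
          ordered (!β) ⟨a, false, sa⟩ ⟨c, true, sc⟩ ++ v ++
          ordered (!γ) ⟨b, false, sb⟩ ⟨c, false, sc⟩ ++ w)
  /-- The same move, if the strands follow one another as top, bottom, middle. -/
  | r3' (a b c : ℕ) (sa sb sc α β γ : Bool) (u v w : List Letter)
      (hβ : (α = β) ↔ (sb = sc)) (hγ : (α = γ) ↔ (sa = sc)) :
      ReidemeisterStep
        (ordered α ⟨a, true, sa⟩ ⟨b, true, sb⟩ ++ u ++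
          ordered γ ⟨b, false, sb⟩ ⟨c, false, sc⟩ ++ v ++
          ordered β ⟨a, false, sa⟩ ⟨c, true, sc⟩ ++ w)
        (ordered (!α) ⟨a, true, sa⟩ ⟨b, true, sb⟩ ++ u ++
          ordered (!γ) ⟨b, false, sb⟩ ⟨c, false, sc⟩ ++ v ++
          ordered (!β) ⟨a, false, sa⟩ ⟨c, true, sc⟩ ++ w)

/-- Knots: knot diagrams up to the equivalence relation generated by the steps above, all
intermediate words being knot diagrams. -/
def Knot : Type := Quot fun D D' : KnotDiagram => ReidemeisterStep D.word D'.word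

/-- The knot represented by a diagram. -/
def KnotDiagram.knot (D : KnotDiagram) : Knot := Quot.mk _ D

/-- The passage `y` follows the passage `x` immediately in the cyclic word `w`. -/
def Follows (w : List Letter) (x y : Letter) : Prop := ∃ u, w ~r (x :: y :: u)

/-- The crossings `a` and `b` form a matched pair: two counter-directed strands are twisted about
each other by a full twist. One strand runs through `a` and then directly through `b`, the other
one through `b` and then directly through `a`; each is once the upper and once the lower one, and
the crossings have the same sign `s`. -/
def IsMatchedPair (w : List Letter) (a b : ℕ) : Prop :=
  a ≠ b ∧ ∃ o s : Bool,
    Follows w ⟨a, o, s⟩ ⟨b, !o, s⟩ ∧ Follows w ⟨b, o, s⟩ ⟨a, !o, s⟩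

/-- Matched diagrams: the crossings are split into disjoint matched pairs `{a, σ a}`. -/
def KnotDiagram.IsMatched (D : KnotDiagram) : Prop :=
  ∃ σ : ℕ → ℕ, ∀ x ∈ D.word,
    σ (σ x.label) = x.label ∧ IsMatchedPair D.word x.label (σ x.label)

/-- A knot is bipartite if it has a matched diagram. -/
def Knot.IsBipartite (K : Knot) : Prop := ∃ D : KnotDiagram, D.knot = K ∧ D.IsMatched

noncomputable section

/-- The ideal generated by the minors of size `k` of a matrix. -/
def minorIdeal {R ι κ : Type*} [CommRing R] (A : Matrix ι κ R) (k : ℕ) : Ideal R :=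
  Ideal.span (Set.range fun p : (Fin k ↪ ι) × (Fin k ↪ κ) => (A.submatrix p.1 p.2).det)

/-- The power `t` or `t⁻¹` that belongs to a positive or a negative crossing. -/
def tPow (s : Bool) : ℤ[T;T⁻¹] := if s then LaurentPolynomial.T 1 else LaurentPolynomial.T (-1)

/-- The Alexander matrix of a diagram, obtained by Fox calculus from the Wirtinger presentation of
the knot group with one generator for each edge of the diagram. The row of a passage `i` with
incoming edge `j` and outgoing edge `i` is the relation `x i = x j` if `i` is the upper passage, and
`x i = t ^ s * x j + (1 - t ^ s) * x k` if `i` is the lower passage through a crossing of sign `s`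
whose upper passage is `k`. The column of the first edge is deleted, so that the matrix presents the
first homology group of the infinite cyclic cover of the knot complement. -/
def KnotDiagram.alexanderMatrix (D : KnotDiagram) :
    Matrix (Fin D.word.length) {e : Fin D.word.length // (e : ℕ) ≠ 0} ℤ[T;T⁻¹] :=
  Matrix.of fun i e =>
    if (D.word.get i).isOver then
      (if e.1 = i then 1 else 0) - (if finRotate _ e.1 = i then 1 else 0)
    else
      (if e.1 = i then 1 else 0)
        - (if finRotate _ e.1 = i then tPow (D.word.get i).isPos else 0)
        - (if Meets D.word i e.1 then 1 - tPow (D.word.get i).isPos else 0)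

/-- The `m`-th Alexander ideal, generated by the minors of size `n - m + 1` of the Alexander matrix,
where `n` is the smaller one of the numbers of its rows and columns. It is the whole ring if
`n - m + 1 ≤ 0`. -/
def KnotDiagram.alexanderIdeal (D : KnotDiagram) (m : ℕ) : Ideal ℤ[T;T⁻¹] :=
  minorIdeal D.alexanderMatrix
    (min (Fintype.card (Fin D.word.length))
      (Fintype.card {e : Fin D.word.length // (e : ℕ) ≠ 0}) + 1 - m)

end

end BipartiteKnots

/-!
The colorings of the arcs of a diagram that satisfy the Alexander relation at every crossing are
the solutions of a linear system, and the Alexander matrix presents the module of its universal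
solution. An Alexander ideal is thus an ideal of minors of any presentation of this module, and it
is unchanged under natural bijections between solutions, in particular under Reidemeister moves.

In a matched diagram the changes of color along the strands of the full twists ("blocks") satisfy
linear relations of their own. On the sphere two cycles cross an even number of times, so two
blocks on the same side of the curve do not contribute to the relations of each other. Eliminating
the blocks on one side leaves a presentation matrix whose entries are fixed by the involution
`t ↦ t⁻¹`, and hence an ideal `I` generated by symmetric elements. For `r ∈ I` the difference of
`r` and its image under the involution lies in `(t - t⁻¹) I`; for `r = 1 + t` this difference is
`t - t⁻¹`, which is not a zero divisor, so `1 ∈ I`.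

The second Alexander ideal of the pretzel knot `P(3, -3, 3)` is generated by `2 - t` and
`2 - t⁻¹`. It contains `1 + t`, and it is proper because it vanishes under `t ↦ -1` modulo `3`.
-/

namespace BipartiteKnots

universe u v

section MinorIdeals

theorem multilinearMap_mem_of_forall_mem_span {R ι N : Type*} {V : ι → Type*} [Finite ι]
    [Semiring R] [∀ i, AddCommMonoid (V i)] [∀ i, Module R (V i)] [AddCommMonoid N] [Module R N]
    (f : MultilinearMap R V N) {S : ∀ i, Set (V i)} {P : Submodule R N}
    (hS : ∀ v, (∀ i, v i ∈ S i) → f v ∈ P) {v : ∀ i, V i}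
    (hv : ∀ i, v i ∈ Submodule.span R (S i)) : f v ∈ P := by
  classical
  cases nonempty_fintype ι
  suffices h : ∀ s : Finset ι, ∀ v : ∀ i, V i, (∀ i ∈ s, v i ∈ Submodule.span R (S i)) →
      (∀ i ∉ s, v i ∈ S i) → f v ∈ P from h Finset.univ v (by simpa using hv) (by simp)
  intro s
  induction s using Finset.induction_on with
  | empty => exact fun v _ hv => hS v fun i => hv i (Finset.notMem_empty i)
  | insert a s ha ih =>
    intro v hspan hmem
    have update_mem : ∀ x ∈ Submodule.span R (S a), f (Function.update v a x) ∈ P := by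
      intro x hx
      induction hx using Submodule.span_induction with
      | mem x hx =>
        refine ih _ (fun i hi => ?_) (fun i hi => ?_)
        · rw [Function.update_of_ne (ne_of_mem_of_not_mem hi ha)]
          exact hspan i (Finset.mem_insert_of_mem hi)
        · obtain rfl | hia := eq_or_ne i a
          · simpa using hx
          · rw [Function.update_of_ne hia]
            exact hmem i (by simp [hia, hi])
      | zero => simp
      | add x y _ _ hx hy => rw [f.map_update_add]; exact P.add_mem hx hy
      | smul r x _ hx => rw [f.map_update_smul]; exact P.smul_mem r hx
    simpa using update_mem (v a) (hspan a (Finset.mem_insert_self a s))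

variable {R ι ι' κ κ' M : Type*} [CommRing R] [AddCommGroup M] [Module R M]

theorem det_submatrix_mem_minorIdeal (A : Matrix ι κ R) {k : ℕ} (p : Fin k → ι) (q : Fin k → κ) :
    (A.submatrix p q).det ∈ minorIdeal A k := by
  by_cases hp : Function.Injective p
  · by_cases hq : Function.Injective q
    · exact Ideal.subset_span ⟨(⟨p, hp⟩, ⟨q, hq⟩), rfl⟩
    · obtain ⟨i, j, hij, hne⟩ := Function.not_injective_iff.1 hq
      rw [Matrix.det_zero_of_column_eq hne fun l => by simp [hij]]
      exact Ideal.zero_mem _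
  · obtain ⟨i, j, hij, hne⟩ := Function.not_injective_iff.1 hp
    rw [Matrix.det_zero_of_row_eq hne (by ext l; simp [hij])]
    exact Ideal.zero_mem _

theorem minorIdeal_le_iff {A : Matrix ι κ R} {k : ℕ} {I : Ideal R} :
    minorIdeal A k ≤ I ↔ ∀ (p : Fin k → ι) (q : Fin k → κ), (A.submatrix p q).det ∈ I := by
  refine ⟨fun h p q => h (det_submatrix_mem_minorIdeal A p q), fun h => Ideal.span_le.2 ?_⟩
  rintro _ ⟨⟨p, q⟩, rfl⟩
  exact h p q

theorem minorIdeal_zero (A : Matrix ι κ R) : minorIdeal A 0 = ⊤ := by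
  rw [Ideal.eq_top_iff_one]
  simpa using det_submatrix_mem_minorIdeal A (k := 0) Fin.elim0 Fin.elim0

theorem minorIdeal_mono_of_mem_span {A : Matrix ι κ R} {B : Matrix ι' κ R}
    (h : ∀ i, B i ∈ Submodule.span R (Set.range A)) (k : ℕ) :
    minorIdeal B k ≤ minorIdeal A k := by
  refine minorIdeal_le_iff.2 fun p q => ?_
  let f : MultilinearMap R (fun _ : Fin k => κ → R) R :=
    (Matrix.detRowAlternating (R := R) (n := Fin k)).toMultilinearMap.compLinearMap
      fun _ => LinearMap.funLeft R R q
  refine multilinearMap_mem_of_forall_mem_span f (v := fun i => B (p i)) (fun v hv => ?_)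
    fun i => h (p i)
  choose r hr using hv
  obtain rfl : (fun i => A (r i)) = v := funext hr
  exact det_submatrix_mem_minorIdeal A r q

theorem minorIdeal_eq_of_span_eq {A : Matrix ι κ R} {B : Matrix ι' κ R}
    (h : Submodule.span R (Set.range A) = Submodule.span R (Set.range B)) (k : ℕ) :
    minorIdeal A k = minorIdeal B k :=
  le_antisymm
    (minorIdeal_mono_of_mem_span (fun i => h ▸ Submodule.subset_span ⟨i, rfl⟩) k)
    (minorIdeal_mono_of_mem_span (fun i => h ▸ Submodule.subset_span ⟨i, rfl⟩) k)

/-- The block matrix `[[1, -a], [0, A]]`: if `A` presents a module, it presents the same module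
with the redundant generator `∑ k, a k • x k` added. -/
def addGenerator (A : Matrix ι κ R) (a : κ → R) : Matrix (Option ι) (Option κ) R :=
  Matrix.of fun i j => i.elim (j.elim 1 fun k => -a k) fun i => j.elim 0 (A i)

theorem det_submatrix_addGenerator_some_mem (A : Matrix ι κ R) (a : κ → R) {k : ℕ}
    (p : Fin k → ι) (q : Fin k → Option κ) :
    ((addGenerator A a).submatrix (fun i => some (p i)) q).det ∈ minorIdeal A k := by
  by_cases hq : ∃ i, q i = none
  · obtain ⟨i, hi⟩ := hq
    rw [Matrix.det_eq_zero_of_column_eq_zero i fun l => by simp [hi, addGenerator]]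
    exact Ideal.zero_mem _
  · push Not at hq
    choose r hr using fun i => Option.ne_none_iff_exists'.1 (hq i)
    convert det_submatrix_mem_minorIdeal A p r using 2
    ext i j
    simp [addGenerator, hr]

theorem minorIdeal_addGenerator_le (A : Matrix ι κ R) (a : κ → R) (k : ℕ) :
    minorIdeal (addGenerator A a) (k + 1) ≤ minorIdeal A k := by
  refine Ideal.span_le.2 ?_
  rintro _ ⟨⟨p, q⟩, rfl⟩
  obtain ⟨i₀, hi₀⟩ : ∃ i₀ : Fin (k + 1), ∀ i, i ≠ i₀ → p i ≠ none := by
    by_cases h : ∃ i, p i = none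
    · obtain ⟨i₀, h₀⟩ := h
      exact ⟨i₀, fun i hi h => hi (p.injective (h.trans h₀.symm))⟩
    · push Not at h
      exact ⟨0, fun i _ => h i⟩
  choose r hr using fun i : Fin k =>
    Option.ne_none_iff_exists'.1 (hi₀ _ (Fin.succAbove_ne i₀ i))
  change ((addGenerator A a).submatrix p q).det ∈ minorIdeal A k
  rw [Matrix.det_succ_row _ i₀]
  refine Ideal.sum_mem _ fun j _ => Ideal.mul_mem_left _ _ ?_
  convert det_submatrix_addGenerator_some_mem A a r (fun i => q (j.succAbove i)) using 2
  ext i l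
  simp [hr]

theorem le_minorIdeal_addGenerator (A : Matrix ι κ R) (a : κ → R) (k : ℕ) :
    minorIdeal A k ≤ minorIdeal (addGenerator A a) (k + 1) := by
  refine minorIdeal_le_iff.2 fun p q => ?_
  have h := det_submatrix_mem_minorIdeal (addGenerator A a) (k := k + 1)
    (Fin.cons none fun i => some (p i)) (Fin.cons none fun i => some (q i))
  rw [Matrix.det_succ_column_zero, Fin.sum_univ_succ,
    Finset.sum_eq_zero fun i _ => by simp [addGenerator]] at h
  simpa [addGenerator, Matrix.submatrix] using h

theorem minorIdeal_addGenerator (A : Matrix ι κ R) (a : κ → R) (k : ℕ) :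
    minorIdeal (addGenerator A a) (k + 1) = minorIdeal A k :=
  (minorIdeal_addGenerator_le A a k).antisymm (le_minorIdeal_addGenerator A a k)

end MinorIdeals

section Fitting

variable {R ι ι' κ κ' M : Type*} [CommRing R] [AddCommGroup M] [Module R M]
  [Fintype κ] [Fintype κ']

/-- The module of linear relations between the elements of a finite family. -/
def relations (R : Type*) [CommRing R] [Module R M] (x : κ → M) : Submodule R (κ → R) :=
  LinearMap.ker (Fintype.linearCombination R x)

theorem mem_relations {x : κ → M} {v : κ → R} : v ∈ relations R x ↔ ∑ k, v k • x k = 0 := by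
  simp [relations, Fintype.linearCombination_apply]

/-- The rows of `A` generate the relations between the generators `x` of the module `M`. -/
structure IsPresentation (A : Matrix ι κ R) (x : κ → M) : Prop where
  span_eq_top : Submodule.span R (Set.range x) = ⊤
  relations_eq : relations R x = Submodule.span R (Set.range A)

/-- The matrix whose rows are all linear relations between the elements of a finite family. -/
def relationMatrix (R : Type*) [CommRing R] [Module R M] (x : κ → M) :
    Matrix (relations R x) κ R :=
  fun v => v.1

theorem span_range_relationMatrix (x : κ → M) :
    Submodule.span R (Set.range (relationMatrix R x)) = relations R x := by
  rw [show Set.range (relationMatrix R x) = relations R x from Subtype.range_coe]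
  exact Submodule.span_eq _

/-- The `m`-th Fitting ideal of the module spanned by `x`, computed from the generators `x` and
numbered like the Alexander ideals: the `m`-th one here is usually called the `(m - 1)`-st. -/
def fittingIdeal (R : Type*) [CommRing R] [Module R M] (x : κ → M) (m : ℕ) : Ideal R :=
  minorIdeal (relationMatrix R x) (Fintype.card κ + 1 - m)

theorem IsPresentation.minorIdeal_eq_fittingIdeal {A : Matrix ι κ R} {x : κ → M}
    (h : IsPresentation A x) (m : ℕ) :
    minorIdeal A (Fintype.card κ + 1 - m) = fittingIdeal R x m :=
  minorIdeal_eq_of_span_eq (by rw [span_range_relationMatrix, h.relations_eq]) _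

theorem minorIdeal_relationMatrix_comp_le (x : κ → M) (e : κ' ≃ κ) (k : ℕ) :
    minorIdeal (relationMatrix R (x ∘ e)) k ≤ minorIdeal (relationMatrix R x) k := by
  refine minorIdeal_le_iff.2 fun p q => ?_
  have comp_symm_mem (v : relations R (x ∘ e)) : v.1 ∘ e.symm ∈ relations R x := by
    rw [mem_relations, ← e.sum_comp]
    simpa using mem_relations.1 v.2
  convert det_submatrix_mem_minorIdeal (relationMatrix R x)
    (fun i => ⟨_, comp_symm_mem (p i)⟩) (e ∘ q) using 2
  ext i j
  simp [relationMatrix]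

theorem fittingIdeal_comp_equiv (x : κ → M) (e : κ' ≃ κ) (m : ℕ) :
    fittingIdeal R (x ∘ e) m = fittingIdeal R x m := by
  unfold fittingIdeal
  rw [Fintype.card_congr e]
  refine (minorIdeal_relationMatrix_comp_le x e _).antisymm ?_
  conv_lhs => rw [← Function.comp_id x, ← e.self_comp_symm, ← Function.comp_assoc]
  exact minorIdeal_relationMatrix_comp_le (x ∘ e) e.symm _

theorem relations_option_elim (x : κ → M) (a : κ → R) :
    relations R (fun j : Option κ => j.elim (∑ k, a k • x k) x) =
      Submodule.span R (Set.range (addGenerator (relationMatrix R x) a)) := by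
  apply le_antisymm
  · intro v hv
    have mem : (fun k => v (some k) + v none * a k) ∈ relations R x := by
      rw [mem_relations] at hv ⊢
      simpa [Fintype.sum_option, Finset.smul_sum, add_smul, mul_smul, Finset.sum_add_distrib,
        add_comm] using hv
    have decomposition : v = v none • addGenerator (relationMatrix R x) a none +
        addGenerator (relationMatrix R x) a (some ⟨_, mem⟩) := by
      ext (_ | j) <;> simp [addGenerator, relationMatrix]
    rw [decomposition]
    exact Submodule.add_mem _ (Submodule.smul_mem _ _ (Submodule.subset_span ⟨_, rfl⟩))
      (Submodule.subset_span ⟨_, rfl⟩)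
  · rw [Submodule.span_le]
    rintro _ ⟨_ | v, rfl⟩ <;> rw [SetLike.mem_coe, mem_relations]
    · simp [Fintype.sum_option, addGenerator]
    · simpa [Fintype.sum_option, addGenerator, relationMatrix] using mem_relations.1 v.2

theorem fittingIdeal_option_elim {x : κ → M} (hx : Submodule.span R (Set.range x) = ⊤) (y : M)
    (m : ℕ) : fittingIdeal R (fun j : Option κ => j.elim y x) m = fittingIdeal R x m := by
  obtain ⟨a, rfl⟩ : ∃ a : κ → R, ∑ k, a k • x k = y :=
    (Submodule.mem_span_range_iff_exists_fun R).1 (hx ▸ Submodule.mem_top)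
  unfold fittingIdeal
  rw [minorIdeal_eq_of_span_eq
      ((span_range_relationMatrix _).trans (relations_option_elim x a)), Fintype.card_option]
  rcases Nat.lt_or_ge (Fintype.card κ + 1) m with h | h
  · rw [show Fintype.card κ + 1 + 1 - m = 0 by omega, show Fintype.card κ + 1 - m = 0 by omega,
      minorIdeal_zero, minorIdeal_zero]
  · rw [Nat.sub_add_comm h, minorIdeal_addGenerator]

theorem fittingIdeal_sum_elim {x : κ → M} (hx : Submodule.span R (Set.range x) = ⊤) (m : ℕ)
    (y : κ' → M) : fittingIdeal R (Sum.elim x y) m = fittingIdeal R x m := by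
  revert y
  refine Fintype.induction_empty_option
    (P := fun α _ => ∀ y : α → M, fittingIdeal R (Sum.elim x y) m = fittingIdeal R x m) ?_ ?_ ?_ κ'
  · intro α β _ e ih y
    let := Fintype.ofEquiv β e.symm
    rw [← ih (y ∘ e), ← fittingIdeal_comp_equiv _ ((Equiv.refl κ).sumCongr e)]
    congr 1
    ext (_ | _) <;> rfl
  · intro y
    rw [← fittingIdeal_comp_equiv x (Equiv.sumEmpty κ PEmpty)]
    congr 1
    ext (_ | ⟨⟨⟩⟩)
    rfl
  · intro α _ ih y
    let e : κ ⊕ Option α ≃ Option (κ ⊕ α) :=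
      { toFun := Sum.elim (some ∘ Sum.inl) fun o => o.map Sum.inr
        invFun := fun o => o.elim (Sum.inr none) (Sum.map id some)
        left_inv := by rintro (_ | _ | _) <;> rfl
        right_inv := by rintro (_ | _ | _) <;> rfl }
    have span_eq_top : Submodule.span R (Set.range (Sum.elim x (y ∘ some))) = ⊤ := by
      simp [Set.Sum.elim_range, Submodule.span_union, hx]
    rw [← ih (y ∘ some), ← fittingIdeal_option_elim span_eq_top (y none),
      ← fittingIdeal_comp_equiv _ e]
    congr 1
    ext (_ | _ | _) <;> rfl

theorem fittingIdeal_eq_of_span_eq_top {x : κ → M} {y : κ' → M}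
    (hx : Submodule.span R (Set.range x) = ⊤) (hy : Submodule.span R (Set.range y) = ⊤) (m : ℕ) :
    fittingIdeal R x m = fittingIdeal R y m := by
  rw [← fittingIdeal_sum_elim hx m y, ← fittingIdeal_sum_elim hy m x,
    ← fittingIdeal_comp_equiv (Sum.elim y x) (Equiv.sumComm κ κ')]
  congr 1
  ext (_ | _) <;> rfl

theorem IsPresentation.minorIdeal_eq {A : Matrix ι κ R} {B : Matrix ι' κ' R} {x : κ → M}
    {y : κ' → M} (hA : IsPresentation A x) (hB : IsPresentation B y) (m : ℕ) :
    minorIdeal A (Fintype.card κ + 1 - m) = minorIdeal B (Fintype.card κ' + 1 - m) := by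
  rw [hA.minorIdeal_eq_fittingIdeal, hB.minorIdeal_eq_fittingIdeal]
  exact fittingIdeal_eq_of_span_eq_top hA.span_eq_top hB.span_eq_top m

end Fitting

section Systems

variable {R : Type u} [CommRing R]

/-- A condition on families, indexed by `J`, of elements of `R`-modules, such as a system of
linear equations; the modules range over all coefficients in which it may be solved. -/
abbrev System (R : Type u) [CommRing R] (J : Type v) : Type (max (u + 1) v) :=
  ∀ (X : Type u) [AddCommGroup X] [Module R X], (J → X) → Prop

/-- A bijection between the solutions of two systems that is natural in the module of
coefficients. By Yoneda, such systems have the same universal solution module. -/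
structure SolutionIso {J J' : Type*} (P : System R J) (Q : System R J') where
  toFun : ∀ {X : Type u} [AddCommGroup X] [Module R X], (J → X) → J' → X
  invFun : ∀ {X : Type u} [AddCommGroup X] [Module R X], (J' → X) → J → X
  map_toFun : ∀ {X Y : Type u} [AddCommGroup X] [Module R X] [AddCommGroup Y] [Module R Y]
    (φ : X →ₗ[R] Y) (c : J → X), φ ∘ toFun c = toFun (φ ∘ c)
  map_invFun : ∀ {X Y : Type u} [AddCommGroup X] [Module R X] [AddCommGroup Y] [Module R Y]
    (φ : X →ₗ[R] Y) (c : J' → X), φ ∘ invFun c = invFun (φ ∘ c)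
  toFun_mem : ∀ {X : Type u} [AddCommGroup X] [Module R X] {c : J → X}, P X c → Q X (toFun c)
  invFun_mem : ∀ {X : Type u} [AddCommGroup X] [Module R X] {c : J' → X}, Q X c → P X (invFun c)
  left_inv : ∀ {X : Type u} [AddCommGroup X] [Module R X] {c : J → X}, P X c →
    invFun (toFun c) = c
  right_inv : ∀ {X : Type u} [AddCommGroup X] [Module R X] {c : J' → X}, Q X c →
    toFun (invFun c) = c

namespace SolutionIso

variable {J J' J'' : Type*} {P P' : System R J} {Q : System R J'} {S : System R J''}

/-- Equivalent systems have the same solutions. -/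
def ofIff (h : ∀ (X : Type u) [AddCommGroup X] [Module R X] (c : J → X), P X c ↔ P' X c) :
    SolutionIso P P' where
  toFun c := c
  invFun c := c
  map_toFun _ _ := rfl
  map_invFun _ _ := rfl
  toFun_mem := (h _ _).1
  invFun_mem := (h _ _).2
  left_inv _ := rfl
  right_inv _ := rfl

/-- The inverse of a natural bijection. -/
def symm (e : SolutionIso P Q) : SolutionIso Q P where
  toFun := e.invFun
  invFun := e.toFun
  map_toFun := e.map_invFun
  map_invFun := e.map_toFun
  toFun_mem := e.invFun_mem
  invFun_mem := e.toFun_mem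
  left_inv := e.right_inv
  right_inv := e.left_inv

/-- The composition of natural bijections. -/
def trans (e : SolutionIso P Q) (f : SolutionIso Q S) : SolutionIso P S where
  toFun c := f.toFun (e.toFun c)
  invFun c := e.invFun (f.invFun c)
  map_toFun φ c := by rw [f.map_toFun, e.map_toFun]
  map_invFun φ c := by rw [e.map_invFun, f.map_invFun]
  toFun_mem hc := f.toFun_mem (e.toFun_mem hc)
  invFun_mem hc := e.invFun_mem (f.invFun_mem hc)
  left_inv hc := by rw [f.left_inv (e.toFun_mem hc), e.left_inv hc]
  right_inv hc := by rw [e.right_inv (f.invFun_mem hc), f.right_inv hc]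

end SolutionIso

/-- A solution of which every other one is the image under exactly one linear map. -/
structure IsUniversal {J : Type*} (P : System R J) {M : Type u} [AddCommGroup M] [Module R M]
    (x : J → M) : Prop where
  mem : P M x
  existsUnique : ∀ (X : Type u) [AddCommGroup X] [Module R X] (c : J → X), P X c →
    ∃! φ : M →ₗ[R] X, φ ∘ x = c

theorem IsUniversal.toFun {J J' : Type*} {P : System R J} {Q : System R J'} {M : Type u}
    [AddCommGroup M] [Module R M] {x : J → M} (hx : IsUniversal P x) (e : SolutionIso P Q) :
    IsUniversal Q (e.toFun x) where
  mem := e.toFun_mem hx.mem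
  existsUnique X _ _ c hc := by
    obtain ⟨φ, hφ, unique⟩ := hx.existsUnique X (e.invFun c) (e.invFun_mem hc)
    refine ⟨φ, ?_, fun ψ hψ => unique ψ ?_⟩
    · simp only [e.map_toFun, hφ, e.right_inv hc]
    · rw [← hψ, ← e.map_invFun, e.left_inv hx.mem]

variable {ι ι' : Type*} {κ κ' : Type u} [Fintype κ] [Fintype κ']

/-- The homogeneous system of linear equations with the coefficient matrix `A`. -/
def matrixSystem (A : Matrix ι κ R) : System R κ :=
  fun _ _ _ c => ∀ i, ∑ k, A i k • c k = 0

/-- The module presented by the rows of `A`. -/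
abbrev RowQuotient (A : Matrix ι κ R) : Type u :=
  (κ → R) ⧸ Submodule.span R (Set.range A)

open Classical in
/-- The standard generators of the module presented by the rows of `A`. -/
noncomputable def rowQuotientGen (A : Matrix ι κ R) (k : κ) : RowQuotient A :=
  Submodule.Quotient.mk (Pi.single k 1)

theorem sum_smul_rowQuotientGen (A : Matrix ι κ R) (v : κ → R) :
    ∑ k, v k • rowQuotientGen A k = Submodule.Quotient.mk v := by
  classical
  conv_rhs => rw [pi_eq_sum_univ' v]
  simp only [rowQuotientGen, ← Submodule.mkQ_apply, map_sum, map_smul]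

theorem isUniversal_rowQuotientGen (A : Matrix ι κ R) :
    IsUniversal (matrixSystem A) (rowQuotientGen A) where
  mem i := by
    rw [sum_smul_rowQuotientGen, Submodule.Quotient.mk_eq_zero]
    exact Submodule.subset_span ⟨i, rfl⟩
  existsUnique X _ _ c hc := by
    classical
    refine ⟨Submodule.liftQ _ (Fintype.linearCombination R c) ?_, ?_, fun ψ hψ => ?_⟩
    · rw [Submodule.span_le]
      rintro _ ⟨i, rfl⟩
      simpa [Fintype.linearCombination_apply] using hc i
    · ext k
      simp [rowQuotientGen]
    · refine Submodule.linearMap_qext _ (LinearMap.pi_ext' fun k => LinearMap.ext_ring ?_)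
      simpa [rowQuotientGen] using congrFun hψ k

namespace IsUniversal

variable {A : Matrix ι κ R} {M : Type u} [AddCommGroup M] [Module R M] {x : κ → M}

theorem span_range_eq_top (hx : IsUniversal (matrixSystem A) x) :
    Submodule.span R (Set.range x) = ⊤ := by
  have mkQ_eq_zero : (Submodule.span R (Set.range x)).mkQ = 0 :=
    (hx.existsUnique _ (fun _ => 0) fun i => by simp).unique
      (funext fun k => (Submodule.Quotient.mk_eq_zero _).2 (Submodule.subset_span ⟨k, rfl⟩)) rfl
  rw [← Submodule.ker_mkQ (Submodule.span R (Set.range x)), mkQ_eq_zero, LinearMap.ker_zero]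

theorem relations_eq_span_range (hx : IsUniversal (matrixSystem A) x) :
    relations R x = Submodule.span R (Set.range A) := by
  apply le_antisymm
  · intro v hv
    obtain ⟨φ, hφ, -⟩ := hx.existsUnique _ _ (isUniversal_rowQuotientGen A).mem
    rw [← Submodule.Quotient.mk_eq_zero, ← sum_smul_rowQuotientGen]
    simpa [← hφ] using congrArg φ (mem_relations.1 hv)
  · rw [Submodule.span_le]
    rintro _ ⟨i, rfl⟩
    exact mem_relations.2 (hx.mem i)

theorem isPresentation (hx : IsUniversal (matrixSystem A) x) : IsPresentation A x :=
  ⟨hx.span_range_eq_top, hx.relations_eq_span_range⟩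

end IsUniversal

theorem SolutionIso.minorIdeal_eq {A : Matrix ι κ R} {B : Matrix ι' κ' R}
    (e : SolutionIso (matrixSystem A) (matrixSystem B)) (m : ℕ) :
    minorIdeal A (Fintype.card κ + 1 - m) = minorIdeal B (Fintype.card κ' + 1 - m) :=
  (isUniversal_rowQuotientGen A).isPresentation.minorIdeal_eq
    ((isUniversal_rowQuotientGen A).toFun e).isPresentation m

end Systems

section Coloring

variable {X Y : Type*} [AddCommGroup X] [Module ℤ[T;T⁻¹] X] [AddCommGroup Y] [Module ℤ[T;T⁻¹] Y]

theorem tPow_mul_tPow_not (s : Bool) : tPow s * tPow (!s) = 1 := by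
  rw [← LaurentPolynomial.T_zero]
  cases s <;> exact (LaurentPolynomial.T_add _ _).symm

theorem tPow_smul_tPow_not_smul (s : Bool) (x : X) : tPow s • tPow (!s) • x = x := by
  rw [smul_smul, tPow_mul_tPow_not, one_smul]

theorem tPow_not_smul_tPow_smul (s : Bool) (x : X) : tPow (!s) • tPow s • x = x := by
  simpa using tPow_smul_tPow_not_smul (!s) x

theorem tPow_not_smul_eq_iff {s : Bool} {x y : X} : tPow (!s) • x = y ↔ x = tPow s • y :=
  ⟨fun h => by rw [← h, tPow_smul_tPow_not_smul], fun h => by rw [h, tPow_not_smul_tPow_smul]⟩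

theorem tPow_smul_inj {s : Bool} {x y : X} : tPow s • x = tPow s • y ↔ x = y := by
  rw [← tPow_not_smul_eq_iff, tPow_not_smul_tPow_smul]

/-- The color of the strand behind a passage, computed from the color `x` in front of it and the
colors `c` of the upper strands of the crossings: Alexander colorings satisfy the relations of the
Alexander module. -/
noncomputable def pass (c : ℕ → X) (x : X) (l : Letter) : X :=
  if l.isOver then x else tPow l.isPos • x + (1 - tPow l.isPos) • c l.label

/-- The color behind a sequence of passages, computed from the color `x` in front of it. -/
noncomputable def endColor (c : ℕ → X) (w : List Letter) (x : X) : X := w.foldl (pass c) x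

/-- The color changes from `x` to `y` along `w`, and `c` gives the colors of the upper
passages. -/
def Runs (c : ℕ → X) : List Letter → X → X → Prop
  | [], x, y => x = y
  | l :: w, x, y => (l.isOver = true → c l.label = x) ∧ Runs c w (pass c x l) y

theorem runs_nil {c : ℕ → X} {x y : X} : Runs c [] x y ↔ x = y := Iff.rfl

theorem runs_cons_over {c : ℕ → X} {a : ℕ} {s : Bool} {w : List Letter} {x y : X} :
    Runs c (⟨a, true, s⟩ :: w) x y ↔ c a = x ∧ Runs c w x y := by
  simp [Runs, pass]

theorem runs_cons_under {c : ℕ → X} {a : ℕ} {s : Bool} {w : List Letter} {x y : X} :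
    Runs c (⟨a, false, s⟩ :: w) x y ↔ Runs c w (tPow s • x + (1 - tPow s) • c a) y := by
  simp [Runs, pass]

theorem runs_append {c : ℕ → X} {u v : List Letter} {x y : X} :
    Runs c (u ++ v) x y ↔ ∃ z, Runs c u x z ∧ Runs c v z y := by
  induction u generalizing x with
  | nil => simp [Runs]
  | cons l u ih => simp [Runs, ih, and_assoc]

theorem Runs.endColor_eq {c : ℕ → X} {w : List Letter} {x y : X} (h : Runs c w x y) :
    endColor c w x = y := by
  induction w generalizing x with
  | nil => exact h
  | cons l w ih => exact ih h.2

theorem runs_congr {c c' : ℕ → X} {w : List Letter}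
    (h : ∀ a ∈ w.map Letter.label, c a = c' a) {x y : X} : Runs c w x y ↔ Runs c' w x y := by
  induction w generalizing x with
  | nil => rfl
  | cons l w ih =>
    simp only [List.map_cons, List.mem_cons, forall_eq_or_imp] at h
    simp only [Runs, pass, h.1, ih h.2]

theorem map_endColor (φ : X →ₗ[ℤ[T;T⁻¹]] Y) (c : ℕ → X) (w : List Letter) (x : X) :
    φ (endColor c w x) = endColor (φ ∘ c) w (φ x) := by
  have map_pass (x : X) (l : Letter) : φ (pass c x l) = pass (φ ∘ c) (φ x) l := by
    unfold pass
    split_ifs <;> simp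
  induction w generalizing x with
  | nil => rfl
  | cons l w ih => simpa only [endColor, List.foldl_cons, map_pass] using ih (pass c x l)

/-- The Alexander colorings of a word in which the initial strand has the color zero; they are
represented by the colors of the upper strands of the crossings. -/
def coloringSystem (w : List Letter) : System ℤ[T;T⁻¹] ℕ :=
  fun _ _ _ c => (∀ a, a ∉ w.map Letter.label → c a = 0) ∧ Runs c w 0 0

end Coloring

section Rotation

variable {X Y : Type*} [AddCommGroup X]

open Classical in
/-- The colors `c` of the crossings of `w`, translated so that `z` becomes zero. -/
noncomputable def rebase (w : List Letter) (z : X) (c : ℕ → X) (a : ℕ) : X :=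
  if a ∈ w.map Letter.label then c a - z else 0

theorem rebase_of_mem {w : List Letter} {a : ℕ} (ha : a ∈ w.map Letter.label) (z : X)
    (c : ℕ → X) : rebase w z c a = c a - z := if_pos ha

theorem rebase_of_notMem {w : List Letter} {a : ℕ} (ha : a ∉ w.map Letter.label) (z : X)
    (c : ℕ → X) : rebase w z c a = 0 := if_neg ha

variable [Module ℤ[T;T⁻¹] X] [AddCommGroup Y] [Module ℤ[T;T⁻¹] Y]

theorem map_rebase (φ : X →ₗ[ℤ[T;T⁻¹]] Y) (w : List Letter) (z : X) (c : ℕ → X) :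
    φ ∘ rebase w z c = rebase w (φ z) (φ ∘ c) := by
  ext a
  simp only [rebase, Function.comp_apply]
  split_ifs <;> simp

theorem Runs.rebase {c : ℕ → X} {w w' : List Letter} {x y : X} (h : Runs c w x y) (hw : w ⊆ w')
    (z : X) : Runs (rebase w' z c) w (x - z) (y - z) := by
  induction w generalizing x with
  | nil => simpa [Runs] using h
  | cons l w ih =>
    have hl := rebase_of_mem (List.mem_map_of_mem (hw List.mem_cons_self)) z c
    refine ⟨fun ho => by rw [hl, h.1 ho], ?_⟩
    convert ih h.2 fun a ha => hw (List.mem_cons_of_mem l ha) using 1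
    unfold pass
    split_ifs
    · rfl
    · rw [hl]; module

theorem rebase_coloring {u v : List Letter} {X : Type} [AddCommGroup X] [Module ℤ[T;T⁻¹] X]
    {c : ℕ → X} (hc : coloringSystem (u ++ v) X c) :
    coloringSystem (v ++ u) X (rebase (u ++ v) (endColor c u 0) c) ∧
      endColor (rebase (u ++ v) (endColor c u 0) c) v 0 = -endColor c u 0 := by
  obtain ⟨z, hu, hv⟩ := runs_append.1 hc.2
  rw [hu.endColor_eq]
  have hu' := hu.rebase (List.subset_append_left u v) z
  have hv' := hv.rebase (List.subset_append_right u v) z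
  rw [sub_self, zero_sub] at hu' hv'
  refine ⟨⟨fun a ha => rebase_of_notMem ?_ z c, runs_append.2 ⟨_, hv', hu'⟩⟩, hv'.endColor_eq⟩
  simpa [or_comm] using ha

theorem rebase_rebase_coloring {u v : List Letter} {X : Type} [AddCommGroup X]
    [Module ℤ[T;T⁻¹] X] {c : ℕ → X} (hc : coloringSystem (u ++ v) X c) :
    let c' := rebase (u ++ v) (endColor c u 0) c
    rebase (v ++ u) (endColor c' v 0) c' = c := by
  intro c'
  ext a
  have mem_iff : a ∈ (v ++ u).map Letter.label ↔ a ∈ (u ++ v).map Letter.label := by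
    simp [or_comm]
  by_cases ha : a ∈ (u ++ v).map Letter.label
  · rw [rebase_of_mem (mem_iff.2 ha), (rebase_coloring hc).2,
      show c' a = c a - endColor c u 0 from rebase_of_mem ha _ c, sub_neg_eq_add, sub_add_cancel]
  · rw [rebase_of_notMem (mt mem_iff.1 ha), hc.1 a ha]

/-- Moving the starting point of a word translates its colorings. -/
noncomputable def rotateIso (u v : List Letter) :
    SolutionIso (coloringSystem (u ++ v)) (coloringSystem (v ++ u)) where
  toFun c := rebase (u ++ v) (endColor c u 0) c
  invFun c := rebase (v ++ u) (endColor c v 0) c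
  map_toFun φ c := by rw [map_rebase, map_endColor, map_zero]
  map_invFun φ c := by rw [map_rebase, map_endColor, map_zero]
  toFun_mem hc := (rebase_coloring hc).1
  invFun_mem hc := (rebase_coloring hc).1
  left_inv hc := rebase_rebase_coloring hc
  right_inv hc := rebase_rebase_coloring hc

theorem nonempty_solutionIso_of_isRotated {w w' : List Letter} (h : w ~r w') :
    Nonempty (SolutionIso (coloringSystem w) (coloringSystem w')) := by
  obtain ⟨n, hn, rfl⟩ := List.isRotated_iff_mod.1 h
  rw [List.rotate_eq_drop_append_take hn]
  conv in coloringSystem w => rw [← List.take_append_drop n w]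
  exact ⟨rotateIso _ _⟩

end Rotation

section Relabeling

variable {X Y : Type*} [AddCommGroup X] [Module ℤ[T;T⁻¹] X] [AddCommGroup Y] [Module ℤ[T;T⁻¹] Y]

theorem map_label_map_relabel (f : ℕ → ℕ) (w : List Letter) :
    (w.map (Letter.relabel f)).map Letter.label = (w.map Letter.label).map f := by
  simp [Function.comp_def, Letter.relabel]

theorem runs_map_relabel {f : ℕ → ℕ} {c : ℕ → X} {w : List Letter} {x y : X} :
    Runs c (w.map (Letter.relabel f)) x y ↔ Runs (c ∘ f) w x y := by
  induction w generalizing x with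
  | nil => rfl
  | cons l w ih => simp only [List.map_cons, Runs, ih]; rfl

theorem map_extend_zero {α β M N F : Type*} [Zero M] [Zero N] [FunLike F M N] [ZeroHomClass F M N]
    (φ : F) (f : α → β) (c : α → M) :
    φ ∘ Function.extend f c 0 = Function.extend f (φ ∘ c) 0 := by
  ext b
  rw [Function.comp_apply, Function.apply_extend φ]
  congr 1
  exact funext fun _ => map_zero φ

/-- Renaming the crossings renames the colors. -/
noncomputable def relabelIso {f : ℕ → ℕ} (hf : Function.Injective f) (w : List Letter) :
    SolutionIso (coloringSystem w) (coloringSystem (w.map (Letter.relabel f))) where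
  toFun c := Function.extend f c 0
  invFun c := c ∘ f
  map_toFun φ c := map_extend_zero φ f c
  map_invFun _ _ := rfl
  toFun_mem {X _ _ c} hc := by
    refine ⟨fun a ha => ?_, ?_⟩
    · rw [map_label_map_relabel] at ha
      by_cases h : ∃ b, f b = a
      · obtain ⟨b, rfl⟩ := h
        rw [hf.extend_apply]
        exact hc.1 b fun hb => ha (List.mem_map_of_mem hb)
      · rw [Function.extend_apply' _ _ _ h, Pi.zero_apply]
    · rw [runs_map_relabel, Function.extend_comp hf]
      exact hc.2
  invFun_mem hc := by
    refine ⟨fun a ha => hc.1 _ ?_, runs_map_relabel.1 hc.2⟩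
    rwa [map_label_map_relabel, List.mem_map_of_injective hf]
  left_inv _ := Function.extend_comp hf _ _
  right_inv {X _ _ c} hc := by
    ext a
    by_cases h : ∃ b, f b = a
    · obtain ⟨b, rfl⟩ := h
      rw [hf.extend_apply, Function.comp_apply]
    · rw [Function.extend_apply' _ _ _ h, Pi.zero_apply, hc.1 a]
      rw [map_label_map_relabel, List.mem_map]
      exact fun ⟨b, _, hb⟩ => h ⟨b, hb⟩

end Relabeling

section FirstAndSecondMove

variable {X : Type*} [AddCommGroup X] [Module ℤ[T;T⁻¹] X]

theorem IsGaussWord.count_label_le_two {w : List Letter} (h : IsGaussWord w) (a : ℕ) :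
    (w.map Letter.label).count a ≤ 2 := by
  rw [List.count_eq_length_filter, List.filter_map, List.length_map]
  set l := w.filter ((fun x => x == a) ∘ Letter.label) with hl
  have mem_w (y : Letter) (hy : y ∈ l) : y ∈ w ∧ y.label = a := by simpa [hl] using hy
  rcases hl' : l with _ | ⟨x, l'⟩
  · simp
  · rw [← hl']
    have hx := mem_w x (by simp [hl'])
    have subset_mates : l ⊆ [x, x.mate] := fun y hy => by
      have hy := mem_w y hy
      simpa using h.eq_or_eq_mate x hx.1 y hy.1 (hy.2.trans hx.2.symm)
    exact ((h.nodup.filter _).subperm subset_mates).length_le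

theorem count_label_ordered (b : Bool) (x y : Letter) (a : ℕ) :
    ((ordered b x y).map Letter.label).count a = [x.label, y.label].count a := by
  cases b <;> simp [ordered, List.count_cons, add_comm]

theorem mem_map_label_ordered {b : Bool} {x y : Letter} {a : ℕ} :
    a ∈ (ordered b x y).map Letter.label ↔ a = x.label ∨ a = y.label := by
  cases b <;> simp [ordered, or_comm]

theorem runs_kink {c : ℕ → X} {a : ℕ} {o s : Bool} {x y : X} :
    Runs c [⟨a, o, s⟩, ⟨a, !o, s⟩] x y ↔ c a = x ∧ y = x := by
  have color_eq (h : c a = x) : tPow s • x + (1 - tPow s) • c a = x := by rw [h]; module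
  cases o
  · simp only [Bool.not_false, runs_cons_under, runs_cons_over, runs_nil]
    constructor
    · rintro ⟨h, rfl⟩
      have : tPow s • c a = tPow s • x := by
        rw [← sub_eq_zero, ← sub_eq_zero.2 h]
        module
      rw [tPow_smul_inj] at this
      exact ⟨this, color_eq this⟩
    · rintro ⟨h, rfl⟩
      rw [color_eq h]
      exact ⟨h, rfl⟩
  · simp only [Bool.not_true, runs_cons_under, runs_cons_over, runs_nil]
    refine and_congr_right fun h => ?_
    rw [color_eq h, eq_comm]

theorem coloringSystem_kink_iff {a : ℕ} {o s : Bool} {w : List Letter}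
    (hw : IsGaussWord ([⟨a, o, s⟩, ⟨a, !o, s⟩] ++ w)) {X : Type} [AddCommGroup X]
    [Module ℤ[T;T⁻¹] X] {c : ℕ → X} :
    coloringSystem w X c ↔ coloringSystem ([⟨a, o, s⟩, ⟨a, !o, s⟩] ++ w) X c := by
  have ha : a ∉ w.map Letter.label := by
    have := hw.count_label_le_two a
    rw [← List.count_eq_zero]
    simp only [List.cons_append, List.nil_append, List.map_cons, List.count_cons_self] at this
    omega
  simp only [coloringSystem, runs_append, runs_kink]
  constructor
  · rintro ⟨hsupp, hrun⟩
    exact ⟨fun b hb => hsupp b fun h => hb (by simp at h ⊢; tauto), 0, ⟨hsupp a ha, rfl⟩, hrun⟩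
  · rintro ⟨hsupp, z, ⟨hca, rfl⟩, hrun⟩
    refine ⟨fun b hb => ?_, hrun⟩
    obtain rfl | hba := eq_or_ne b a
    · exact hca
    · exact hsupp b (by simp at hb ⊢; tauto)

theorem runs_over_over {c : ℕ → X} {b : Bool} {i j : ℕ} {s s' : Bool} {x y : X} :
    Runs c (ordered b ⟨i, true, s⟩ ⟨j, true, s'⟩) x y ↔ c i = x ∧ c j = x ∧ y = x := by
  cases b <;> simp [ordered, runs_cons_over, runs_nil, eq_comm (a := x)]
  tauto

theorem runs_over_over_append {c : ℕ → X} {b : Bool} {i j : ℕ} {s s' : Bool} {w : List Letter}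
    {x y : X} : Runs c (ordered b ⟨i, true, s⟩ ⟨j, true, s'⟩ ++ w) x y ↔
      c i = x ∧ c j = x ∧ Runs c w x y := by
  simp [runs_append, runs_over_over, and_assoc]

theorem runs_under_under_of_eq_zero {c : ℕ → X} {a b : ℕ} (ha : c a = 0) (hb : c b = 0)
    {d s : Bool} {x y : X} :
    Runs c (ordered d ⟨a, false, s⟩ ⟨b, false, !s⟩) x y ↔ x = y := by
  cases d <;> simp [ordered, runs_cons_under, runs_nil, ha, hb, tPow_smul_tPow_not_smul,
    tPow_not_smul_tPow_smul]

theorem coloringSystem_r2_iff {a b : ℕ} {s d : Bool} {u v : List Letter}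
    (hw : IsGaussWord ([⟨a, true, s⟩, ⟨b, true, !s⟩] ++ u ++
      ordered d ⟨a, false, s⟩ ⟨b, false, !s⟩ ++ v))
    {X : Type} [AddCommGroup X] [Module ℤ[T;T⁻¹] X] {c : ℕ → X} :
    coloringSystem (u ++ v) X c ↔ coloringSystem ([⟨a, true, s⟩, ⟨b, true, !s⟩] ++ u ++
      ordered d ⟨a, false, s⟩ ⟨b, false, !s⟩ ++ v) X c := by
  rw [show [(⟨a, true, s⟩ : Letter), ⟨b, true, !s⟩] = ordered true ⟨a, true, s⟩ ⟨b, true, !s⟩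
    from rfl] at hw ⊢
  have fresh (e : ℕ) (he : e = a ∨ e = b) : e ∉ (u ++ v).map Letter.label := by
    have := hw.count_label_le_two e
    rw [← List.count_eq_zero]
    simp only [List.map_append, List.count_append, count_label_ordered, List.count_cons,
      List.count_nil] at this ⊢
    rcases he with rfl | rfl <;> simp only [beq_self_eq_true, if_true] at this <;> omega
  simp only [coloringSystem, List.append_assoc, runs_over_over_append, List.map_append,
    List.mem_append, mem_map_label_ordered]
  have runs_iff (ha : c a = 0) (hb : c b = 0) : Runs c (u ++ v) 0 0 ↔
      Runs c (u ++ (ordered d ⟨a, false, s⟩ ⟨b, false, !s⟩ ++ v)) 0 0 := by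
    simp [runs_append, runs_under_under_of_eq_zero ha hb]
  simp only [List.map_append, List.mem_append] at fresh
  constructor
  · rintro ⟨hsupp, hrun⟩
    have ha := hsupp a (fresh a (.inl rfl))
    have hb := hsupp b (fresh b (.inr rfl))
    exact ⟨fun e he => hsupp e (by tauto), ha, hb, (runs_iff ha hb).1 hrun⟩
  · rintro ⟨hsupp, ha, hb, hrun⟩
    refine ⟨fun e he => ?_, (runs_iff ha hb).2 hrun⟩
    obtain rfl | hea := eq_or_ne e a
    · exact ha
    obtain rfl | heb := eq_or_ne e b
    · exact hb
    exact hsupp e (by tauto)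

end FirstAndSecondMove

section ThirdMove

variable {X Y : Type*} [AddCommGroup X] [Module ℤ[T;T⁻¹] X] [AddCommGroup Y] [Module ℤ[T;T⁻¹] Y]

/-- Multiplication of the color of the crossing `k` by `r`. For a suitable `r`, this is the effect
of a third Reidemeister move: only the color of the middle strand over the bottom strand changes. -/
noncomputable def rescale (k : ℕ) (r : ℤ[T;T⁻¹]) (c : ℕ → X) : ℕ → X :=
  Function.update c k (r • c k)

theorem rescale_self (k : ℕ) (r : ℤ[T;T⁻¹]) (c : ℕ → X) : rescale k r c k = r • c k := by
  simp [rescale]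

theorem rescale_of_ne {k e : ℕ} (h : e ≠ k) (r : ℤ[T;T⁻¹]) (c : ℕ → X) :
    rescale k r c e = c e := by
  simp [rescale, h]

theorem rescale_rescale_of_mul_eq_one (k : ℕ) {r r' : ℤ[T;T⁻¹]} (h : r' * r = 1) (c : ℕ → X) :
    rescale k r' (rescale k r c) = c := by
  simp [rescale, smul_smul, h]

theorem map_rescale (φ : X →ₗ[ℤ[T;T⁻¹]] Y) (k : ℕ) (r : ℤ[T;T⁻¹]) (c : ℕ → X) :
    φ ∘ rescale k r c = rescale k r (φ ∘ c) := by
  simp [rescale, Function.comp_update]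

theorem runs_rescale_of_notMem {k : ℕ} {w : List Letter} (hk : k ∉ w.map Letter.label)
    {r : ℤ[T;T⁻¹]} {c : ℕ → X} {x y : X} : Runs (rescale k r c) w x y ↔ Runs c w x y :=
  runs_congr fun _ ha => rescale_of_ne (ne_of_mem_of_not_mem ha hk) r c

theorem runs_middle_iff {c c' : ℕ → X} {a k : ℕ} (ha : c a = 0) (ha' : c' a = 0)
    {sa sc β : Bool} (hk : c' k = tPow (xor sa β) • c k) {x y : X} :
    Runs c' (ordered (!β) ⟨a, false, sa⟩ ⟨k, true, sc⟩) x y ↔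
      Runs c (ordered β ⟨a, false, sa⟩ ⟨k, true, sc⟩) x y := by
  cases β <;> simp [ordered, runs_cons_over, runs_cons_under, runs_nil, ha, ha', hk,
    tPow_smul_inj, tPow_not_smul_eq_iff]

theorem runs_bottom_iff {c c' : ℕ → X} {b k : ℕ} (hb : c b = 0) (hb' : c' b = 0)
    {sa sb sc β γ : Bool} (h : (β = γ) ↔ (sa = sb)) (hk : c' k = tPow (xor sa β) • c k) {x y : X} :
    Runs c' (ordered (!γ) ⟨b, false, sb⟩ ⟨k, false, sc⟩) x y ↔
      Runs c (ordered γ ⟨b, false, sb⟩ ⟨k, false, sc⟩) x y := by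
  have xor_eq : xor sa β = xor sb γ := by
    revert h; cases sa <;> cases sb <;> cases β <;> cases γ <;> simp
  rw [xor_eq] at hk
  cases γ <;> simp only [ordered, runs_cons_under, runs_nil, hb, hb', hk, Bool.xor_false,
    Bool.xor_true, Bool.not_false, Bool.not_true, if_true, Bool.false_eq_true, if_false]
  · rw [show tPow sc • (tPow sb • x + (1 - tPow sb) • (0 : X)) + (1 - tPow sc) • tPow sb • c k =
      tPow sb • (tPow sc • x + (1 - tPow sc) • c k) + (1 - tPow sb) • (0 : X) by module]
  · rw [smul_zero, add_zero, add_zero, smul_add, smul_comm (tPow sb) (1 - tPow sc),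
      tPow_smul_tPow_not_smul, smul_comm (tPow sb)]

/-- The word on one side of a third Reidemeister move; `p` tells whether the middle strand comes
before the bottom strand. -/
def triangleWord (p : Bool) (a b k : ℕ) (sa sb sc α β γ : Bool) (u v w : List Letter) :
    List Letter :=
  ordered α ⟨a, true, sa⟩ ⟨b, true, sb⟩ ++ u ++
    (bif p then ordered β ⟨a, false, sa⟩ ⟨k, true, sc⟩
      else ordered γ ⟨b, false, sb⟩ ⟨k, false, sc⟩) ++ v ++
    (bif p then ordered γ ⟨b, false, sb⟩ ⟨k, false, sc⟩
      else ordered β ⟨a, false, sa⟩ ⟨k, true, sc⟩) ++ w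

variable {p : Bool} {a b k : ℕ} {sa sb sc α β γ : Bool} {u v w : List Letter}

theorem mem_map_label_triangleWord {e : ℕ} :
    e ∈ (triangleWord p a b k sa sb sc α β γ u v w).map Letter.label ↔
      e = a ∨ e = b ∨ e = k ∨ e ∈ (u ++ v ++ w).map Letter.label := by
  cases p <;> simp only [triangleWord, cond_true, cond_false, List.map_append, List.mem_append,
    mem_map_label_ordered] <;> tauto

theorem IsGaussWord.triangleWord_fresh
    (hw : IsGaussWord (triangleWord p a b k sa sb sc α β γ u v w)) :
    a ≠ k ∧ b ≠ k ∧ k ∉ u.map Letter.label ∧ k ∉ v.map Letter.label ∧ k ∉ w.map Letter.label := by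
  have h := hw.count_label_le_two k
  have count_bif (x y : List Letter) : ((bif p then x else y).map Letter.label).count k +
      ((bif p then y else x).map Letter.label).count k =
      (x.map Letter.label).count k + (y.map Letter.label).count k := by
    cases p <;> simp [add_comm]
  have := count_bif (ordered β ⟨a, false, sa⟩ ⟨k, true, sc⟩)
    (ordered γ ⟨b, false, sb⟩ ⟨k, false, sc⟩)
  simp only [triangleWord, List.map_append, List.count_append, count_label_ordered,
    List.count_cons, List.count_nil, beq_iff_eq, if_true] at h this
  simp only [← List.count_eq_zero]
  grind

theorem rescale_coloring_triangleWord (hβ : (α = β) ↔ (sb = sc)) (hγ : (α = γ) ↔ (sa = sc))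
    (hw : IsGaussWord (triangleWord p a b k sa sb sc α β γ u v w)) {X : Type} [AddCommGroup X]
    [Module ℤ[T;T⁻¹] X] {c : ℕ → X}
    (hc : coloringSystem (triangleWord p a b k sa sb sc α β γ u v w) X c) :
    coloringSystem (triangleWord p a b k sa sb sc (!α) (!β) (!γ) u v w) X
      (rescale k (tPow (xor sa β)) c) := by
  obtain ⟨hak, hbk, hku, hkv, hkw⟩ := hw.triangleWord_fresh
  set c' := rescale k (tPow (xor sa β)) c with hc'
  have hca' : c' a = c a := rescale_of_ne hak _ c
  have hcb' : c' b = c b := rescale_of_ne hbk _ c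
  have hck' : c' k = tPow (xor sa β) • c k := rescale_self k _ c
  have hβγ : (β = γ) ↔ (sa = sb) := by
    revert hβ hγ
    cases α <;> cases β <;> cases γ <;> cases sa <;> cases sb <;> cases sc <;> simp
  refine ⟨fun e he => ?_, ?_⟩
  · rw [mem_map_label_triangleWord] at he
    rw [hc', rescale_of_ne (by tauto), hc.1 e (by rwa [mem_map_label_triangleWord])]
  · have hrun := hc.2
    simp only [triangleWord, List.append_assoc, runs_over_over_append] at hrun ⊢
    obtain ⟨ha, hb, hrun⟩ := hrun
    rw [ha] at hca'
    rw [hb] at hcb'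
    refine ⟨hca', hcb', ?_⟩
    cases p <;> simpa only [cond_true, cond_false, runs_append, c', runs_rescale_of_notMem hku,
      runs_rescale_of_notMem hkv, runs_rescale_of_notMem hkw, runs_middle_iff ha hca' hck',
      runs_bottom_iff hb hcb' hβγ hck'] using hrun

/-- The colorings before and after a third Reidemeister move. -/
noncomputable def triangleIso (hβ : (α = β) ↔ (sb = sc)) (hγ : (α = γ) ↔ (sa = sc))
    (hw : IsGaussWord (triangleWord p a b k sa sb sc α β γ u v w))
    (hw' : IsGaussWord (triangleWord p a b k sa sb sc (!α) (!β) (!γ) u v w)) :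
    SolutionIso (coloringSystem (triangleWord p a b k sa sb sc α β γ u v w))
      (coloringSystem (triangleWord p a b k sa sb sc (!α) (!β) (!γ) u v w)) where
  toFun := rescale k (tPow (xor sa β))
  invFun := rescale k (tPow (xor sa !β))
  map_toFun φ c := map_rescale φ k _ c
  map_invFun φ c := map_rescale φ k _ c
  toFun_mem hc := rescale_coloring_triangleWord hβ hγ hw hc
  invFun_mem hc := by
    simpa using rescale_coloring_triangleWord (by simpa using hβ) (by simpa using hγ) hw' hc
  left_inv {X _ _ c} _ := by
    refine rescale_rescale_of_mul_eq_one k ?_ c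
    rw [Bool.xor_not, mul_comm, tPow_mul_tPow_not]
  right_inv {X _ _ c} _ := by
    refine rescale_rescale_of_mul_eq_one k ?_ c
    rw [Bool.xor_not, tPow_mul_tPow_not]

end ThirdMove

theorem ReidemeisterStep.nonempty_solutionIso {w w' : List Letter} (h : ReidemeisterStep w w')
    (hw : IsGaussWord w) (hw' : IsGaussWord w') :
    Nonempty (SolutionIso (coloringSystem w) (coloringSystem w')) := by
  cases h with
  | rotate u v => exact ⟨rotateIso u v⟩
  | relabel f hf w => exact ⟨relabelIso hf w⟩
  | r1 a o s w => exact ⟨.ofIff fun _ _ _ _ => coloringSystem_kink_iff hw'⟩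
  | r2 a b s d u v => exact ⟨.ofIff fun _ _ _ _ => coloringSystem_r2_iff hw'⟩
  | r3 a b k sa sb sc α β γ u v w hβ hγ => exact ⟨triangleIso (p := true) hβ hγ hw hw'⟩
  | r3' a b k sa sb sc α β γ u v w hβ hγ => exact ⟨triangleIso (p := false) hβ hγ hw hw'⟩

theorem nonempty_solutionIso_of_knot_eq {D D' : KnotDiagram} (h : D.knot = D'.knot) :
    Nonempty (SolutionIso (coloringSystem D.word) (coloringSystem D'.word)) := by
  have equivalent := Quot.eqvGen_exact h
  clear h
  induction equivalent with
  | rel D D' h => exact h.nonempty_solutionIso D.isGaussWord D'.isGaussWord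
  | refl => exact ⟨.ofIff fun _ _ _ _ => Iff.rfl⟩
  | symm _ _ _ ih => exact ⟨ih.some.symm⟩
  | trans _ _ _ _ _ ih ih' => exact ⟨ih.some.trans ih'.some⟩

section Alexander

theorem val_finRotate {n : ℕ} (i : Fin n) : (finRotate n i : ℕ) = (i + 1) % n := by
  have : NeZero n := ⟨by have := i.2; omega⟩
  rw [finRotate_apply, Fin.val_add, Fin.val_one', Nat.add_mod_mod]

theorem Letter.mate_ne (x : Letter) : x.mate ≠ x := fun h => by
  simpa [Letter.mate] using congrArg Letter.isOver h

theorem IsGaussWord.exists_get_eq_mate {w : List Letter} (hw : IsGaussWord w)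
    (i : Fin w.length) : ∃ k, w.get k = (w.get i).mate ∧ ∀ e, Meets w i e ↔ e = k := by
  obtain ⟨k, hk⟩ := List.get_of_mem (hw.mate_mem _ (List.get_mem w i))
  refine ⟨k, hk, fun e => ⟨fun he => ?_, ?_⟩⟩
  · rcases hw.eq_or_eq_mate _ (List.get_mem w i) _ (List.get_mem w e) he.2.symm with h | h
    · exact absurd (hw.nodup.injective_get h) he.1.symm
    · exact hw.nodup.injective_get (h.trans hk.symm)
  · rintro rfl
    refine ⟨?_, by rw [hk]; rfl⟩
    rintro rfl
    exact Letter.mate_ne _ hk.symm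

section OverColors

variable {X : Type*} [AddCommGroup X]

open Classical in
/-- The colors of the upper strands of the crossings, read off from the colors `Y` of the edges:
the edge `i` is the one behind the passage `i`. -/
noncomputable def overColors (w : List Letter) (Y : Fin w.length → X) (a : ℕ) : X :=
  if h : ∃ i, (w.get i).label = a ∧ (w.get i).isOver = true then Y h.choose else 0

theorem overColors_get {w : List Letter} (hw : IsGaussWord w) (Y : Fin w.length → X)
    {i : Fin w.length} (hi : (w.get i).isOver = true) :
    overColors w Y (w.get i).label = Y i := by
  have h : ∃ k, (w.get k).label = (w.get i).label ∧ (w.get k).isOver = true := ⟨i, rfl, hi⟩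
  rw [overColors, dif_pos h]
  congr 1
  rcases hw.eq_or_eq_mate _ (List.get_mem w i) _ (List.get_mem w h.choose)
    h.choose_spec.1 with heq | hmate
  · exact hw.nodup.injective_get heq
  · have hover := h.choose_spec.2
    rw [hmate, Letter.mate, hi] at hover
    contradiction

theorem overColors_of_notMem {w : List Letter} (Y : Fin w.length → X) {a : ℕ}
    (ha : a ∉ w.map Letter.label) : overColors w Y a = 0 := by
  rw [overColors, dif_neg]
  rintro ⟨i, rfl, -⟩
  exact ha (List.mem_map_of_mem (List.get_mem w i))

theorem overColors_eq {w : List Letter} (hw : IsGaussWord w) {Y : Fin w.length → X} {c : ℕ → X}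
    (hsupp : ∀ a, a ∉ w.map Letter.label → c a = 0)
    (hover : ∀ i, (w.get i).isOver = true → c (w.get i).label = Y i) : overColors w Y = c := by
  ext a
  by_cases ha : a ∈ w.map Letter.label
  · obtain ⟨x, hx, rfl⟩ := List.mem_map.1 ha
    obtain ⟨i, rfl⟩ := List.get_of_mem hx
    obtain ⟨k, hk, -⟩ := hw.exists_get_eq_mate i
    cases ho : (w.get i).isOver
    · have hok : (w.get k).isOver = true := by rw [hk, Letter.mate, ho]; rfl
      rw [show (w.get i).label = (w.get k).label by rw [hk]; rfl, overColors_get hw Y hok,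
        hover k hok]
    · rw [overColors_get hw Y ho, hover i ho]
  · rw [overColors_of_notMem Y ha, hsupp a ha]

/-- The colors of all edges, if the edge `0` has the color zero. -/
def extendEdges {n : ℕ} (y : {e : Fin n // (e : ℕ) ≠ 0} → X) (e : Fin n) : X :=
  if h : (e : ℕ) ≠ 0 then y ⟨e, h⟩ else 0

theorem extendEdges_coe {n : ℕ} (y : {e : Fin n // (e : ℕ) ≠ 0} → X)
    (e : {e : Fin n // (e : ℕ) ≠ 0}) : extendEdges y e = y e := dif_pos e.2

theorem extendEdges_of_eq_zero {n : ℕ} (y : {e : Fin n // (e : ℕ) ≠ 0} → X) (e : Fin n)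
    (he : (e : ℕ) = 0) : extendEdges y e = 0 := dif_neg (not_not.2 he)

end OverColors

variable {X : Type*} [AddCommGroup X] [Module ℤ[T;T⁻¹] X]

theorem endColor_take_succ (c : ℕ → X) {w : List Letter} (x : X) {i : ℕ} (hi : i < w.length) :
    endColor c (w.take (i + 1)) x = pass c (endColor c (w.take i) x) w[i] := by
  rw [List.take_succ_eq_append_getElem hi, endColor, List.foldl_append]
  rfl

theorem runs_iff_getElem {c : ℕ → X} {w : List Letter} {x y : X} :
    Runs c w x y ↔ endColor c w x = y ∧ ∀ (i : ℕ) (hi : i < w.length),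
      w[i].isOver = true → c w[i].label = endColor c (w.take i) x := by
  induction w generalizing x with
  | nil => simp [Runs, endColor]
  | cons l w ih =>
    simp only [Runs, ih]
    refine ⟨fun ⟨h, hend, hover⟩ => ⟨hend, fun i hi => ?_⟩, fun ⟨hend, hover⟩ =>
      ⟨hover 0 (by simp), hend, fun i hi => hover (i + 1) (by simpa using hi)⟩⟩
    cases i with
    | zero => exact h
    | succ i => exact hover i (by simpa using hi)

/-- The colors `Y` of the edges satisfy the relations of the crossings. -/
def IsEdgeColoring (w : List Letter) (Y : Fin w.length → X) : Prop :=
  ∀ j, Y (finRotate _ j) = pass (overColors w Y) (Y j) (w.get (finRotate _ j))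

theorem IsEdgeColoring.eq_of_isOver {w : List Letter} {Y : Fin w.length → X}
    (hY : IsEdgeColoring w Y) {j : Fin w.length} (ho : (w.get (finRotate _ j)).isOver = true) :
    Y (finRotate _ j) = Y j := by
  rw [hY j, pass, if_pos ho]

/-- The color of the edge `e`, if the edge `0`, which is the one behind the first passage, has the
color zero. -/
noncomputable def edgeColor (w : List Letter) (c : ℕ → X) (e : ℕ) : X :=
  endColor c ((w.rotate 1).take e) 0

theorem edgeColor_zero (w : List Letter) (c : ℕ → X) : edgeColor w c 0 = 0 := rfl

theorem getElem_rotate_one {w : List Letter} {j : ℕ} (hj : j < w.length) :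
    (w.rotate 1)[j]'(by simpa using hj) = w.get (finRotate _ ⟨j, hj⟩) := by
  rw [List.getElem_rotate, List.get_eq_getElem]
  congr 1
  rw [val_finRotate]

theorem edgeColor_succ {w : List Letter} (c : ℕ → X) {j : ℕ} (hj : j < w.length) :
    edgeColor w c (j + 1) = pass c (edgeColor w c j) (w.get (finRotate _ ⟨j, hj⟩)) := by
  rw [← getElem_rotate_one hj]
  exact endColor_take_succ c 0 (by simpa using hj)

theorem runs_rotate_one_iff {w : List Letter} {c : ℕ → X} :
    Runs c (w.rotate 1) 0 0 ↔ edgeColor w c w.length = 0 ∧ ∀ j : Fin w.length,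
      (w.get (finRotate _ j)).isOver = true →
        c (w.get (finRotate _ j)).label = edgeColor w c j := by
  have hend : edgeColor w c w.length = endColor c (w.rotate 1) 0 := by
    rw [edgeColor, List.take_of_length_le (by simp)]
  rw [runs_iff_getElem, hend]
  refine and_congr_right fun _ => ⟨fun h j => ?_, fun h i hi => ?_⟩
  · have hj := h j (by simp)
    rwa [getElem_rotate_one j.2] at hj
  · have hi' : i < w.length := by simpa using hi
    rw [getElem_rotate_one hi']
    exact h ⟨i, hi'⟩

theorem edgeColor_finRotate {w : List Letter} {c : ℕ → X} (hend : edgeColor w c w.length = 0)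
    (j : Fin w.length) :
    edgeColor w c (finRotate _ j) = pass c (edgeColor w c j) (w.get (finRotate _ j)) := by
  rw [← edgeColor_succ c j.2, val_finRotate]
  rcases Nat.lt_or_ge (j + 1) w.length with h | h
  · rw [Nat.mod_eq_of_lt h]
  · rw [show (j : ℕ) + 1 = w.length by omega, Nat.mod_self, hend, edgeColor_zero]

theorem overColors_edgeColor {X : Type} [AddCommGroup X] [Module ℤ[T;T⁻¹] X] {w : List Letter}
    (hw : IsGaussWord w) {c : ℕ → X} (hc : coloringSystem (w.rotate 1) X c) :
    overColors w (fun e => edgeColor w c e) = c := by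
  obtain ⟨hend, hover⟩ := runs_rotate_one_iff.1 hc.2
  refine overColors_eq hw (fun a ha => hc.1 a (by simpa [List.map_rotate] using ha)) fun i hi => ?_
  obtain ⟨j, rfl⟩ := (finRotate w.length).surjective i
  rw [hover j hi, edgeColor_finRotate hend, pass, if_pos hi]

theorem isEdgeColoring_edgeColor {X : Type} [AddCommGroup X] [Module ℤ[T;T⁻¹] X]
    {w : List Letter} (hw : IsGaussWord w) {c : ℕ → X}
    (hc : coloringSystem (w.rotate 1) X c) : IsEdgeColoring w (fun e => edgeColor w c e) := by
  intro j
  rw [overColors_edgeColor hw hc]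
  exact edgeColor_finRotate (runs_rotate_one_iff.1 hc.2).1 j

theorem IsEdgeColoring.edgeColor_overColors {w : List Letter} {Y : Fin w.length → X}
    (hY : IsEdgeColoring w Y) (h0 : ∀ e : Fin w.length, (e : ℕ) = 0 → Y e = 0)
    (e : Fin w.length) : edgeColor w (overColors w Y) e = Y e := by
  obtain ⟨e, he⟩ := e
  induction e with
  | zero => rw [h0 _ rfl, edgeColor_zero]
  | succ e ih =>
    have he' : e < w.length := by omega
    rw [edgeColor_succ _ he', ih he', ← hY]
    congr 1
    ext
    rw [val_finRotate]
    exact Nat.mod_eq_of_lt he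

theorem IsEdgeColoring.coloringSystem_overColors {X : Type} [AddCommGroup X]
    [Module ℤ[T;T⁻¹] X] {w : List Letter} (hw : IsGaussWord w) {Y : Fin w.length → X}
    (hY : IsEdgeColoring w Y) (h0 : ∀ e : Fin w.length, (e : ℕ) = 0 → Y e = 0) :
    coloringSystem (w.rotate 1) X (overColors w Y) := by
  refine ⟨fun a ha => overColors_of_notMem Y (by simpa [List.map_rotate] using ha),
    runs_rotate_one_iff.2 ⟨?_, fun j hj => ?_⟩⟩
  · rcases hn : w.length with _ | n
    · exact edgeColor_zero _ _
    · have hn' : n < w.length := by omega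
      rw [edgeColor_succ _ hn', hY.edgeColor_overColors h0 ⟨n, hn'⟩, ← hY]
      refine h0 _ ((val_finRotate _).trans ?_)
      rw [← hn, Nat.mod_self]
  · rw [overColors_get hw Y hj, hY.edgeColor_overColors h0, hY.eq_of_isOver hj]

theorem sum_smul_extendEdges {n : ℕ} (f : Fin n → ℤ[T;T⁻¹])
    (y : {e : Fin n // (e : ℕ) ≠ 0} → X) :
    ∑ e : {e : Fin n // (e : ℕ) ≠ 0}, f e.1 • y e = ∑ e, f e • extendEdges y e := by
  rw [← Fintype.sum_subtype_add_sum_subtype (fun e : Fin n => (e : ℕ) ≠ 0), Finset.sum_eq_zero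
    (s := (Finset.univ : Finset {e : Fin n // ¬ (e : ℕ) ≠ 0})) fun e _ => by
      rw [extendEdges_of_eq_zero y e.1 (not_not.1 e.2), smul_zero], add_zero]
  simp only [extendEdges_coe]

theorem sum_alexanderMatrix_smul (D : KnotDiagram)
    (y : {e : Fin D.word.length // (e : ℕ) ≠ 0} → X) (j : Fin D.word.length) :
    ∑ e, D.alexanderMatrix (finRotate _ j) e • y e = extendEdges y (finRotate _ j) -
      pass (overColors D.word (extendEdges y)) (extendEdges y j)
        (D.word.get (finRotate _ j)) := by
  obtain ⟨k, hk, meets_iff⟩ := D.isGaussWord.exists_get_eq_mate (finRotate _ j)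
  simp only [KnotDiagram.alexanderMatrix, Matrix.of_apply, meets_iff,
    (finRotate D.word.length).injective.eq_iff, pass]
  split_ifs with ho
  · rw [sum_smul_extendEdges fun e => (if e = finRotate _ j then 1 else 0) - if e = j then 1 else 0]
    simp [sub_smul, Finset.sum_sub_distrib, ite_smul]
  · rw [sum_smul_extendEdges fun e => (if e = finRotate _ j then 1 else 0) -
      (if e = j then tPow (D.word.get (finRotate _ j)).isPos else 0) -
      if e = k then 1 - tPow (D.word.get (finRotate _ j)).isPos else 0]
    have hok : (D.word.get k).isOver = true := by
      rw [hk, Letter.mate, Bool.eq_false_of_not_eq_true ho]; rfl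
    have label_eq : (D.word.get (finRotate _ j)).label = (D.word.get k).label := by rw [hk]; rfl
    simp only [sub_smul, Finset.sum_sub_distrib, ite_smul, zero_smul, Finset.sum_ite_eq',
      Finset.mem_univ, if_true, one_smul, label_eq, overColors_get D.isGaussWord _ hok]
    abel

theorem matrixSystem_alexanderMatrix_iff {D : KnotDiagram} {X : Type} [AddCommGroup X]
    [Module ℤ[T;T⁻¹] X] {y : {e : Fin D.word.length // (e : ℕ) ≠ 0} → X} :
    matrixSystem D.alexanderMatrix X y ↔ IsEdgeColoring D.word (extendEdges y) := by
  rw [matrixSystem, ← (finRotate D.word.length).forall_congr_right]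
  simp only [sum_alexanderMatrix_smul, sub_eq_zero, IsEdgeColoring]

theorem extendEdges_edgeColor (w : List Letter) (c : ℕ → X) :
    extendEdges (fun e : {e : Fin w.length // (e : ℕ) ≠ 0} => edgeColor w c (e : Fin w.length)) =
      fun e : Fin w.length => edgeColor w c e := by
  ext e
  unfold extendEdges
  split_ifs with h
  · rfl
  · rw [not_not.1 h, edgeColor_zero]

/-- Solutions of the Alexander matrix are colorings of the edges; the upper strands determine the
other ones. -/
noncomputable def coloringIso (D : KnotDiagram) :
    SolutionIso (coloringSystem (D.word.rotate 1)) (matrixSystem D.alexanderMatrix) where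
  toFun c := fun e => edgeColor D.word c e.1
  invFun y := overColors D.word (extendEdges y)
  map_toFun φ c := by
    ext e
    simp only [Function.comp_apply, edgeColor, map_endColor, map_zero]
  map_invFun φ y := by
    ext a
    simp only [Function.comp_apply, overColors, extendEdges]
    split_ifs <;> simp
  toFun_mem hc := by
    rw [matrixSystem_alexanderMatrix_iff, extendEdges_edgeColor]
    exact isEdgeColoring_edgeColor D.isGaussWord hc
  invFun_mem hy := (matrixSystem_alexanderMatrix_iff.1 hy).coloringSystem_overColors D.isGaussWord
    (extendEdges_of_eq_zero _)
  left_inv hc := by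
    rw [extendEdges_edgeColor]
    exact overColors_edgeColor D.isGaussWord hc
  right_inv {X _ _ y} hy := by
    ext e
    rw [(matrixSystem_alexanderMatrix_iff.1 hy).edgeColor_overColors (extendEdges_of_eq_zero y),
      extendEdges_coe]

theorem KnotDiagram.alexanderIdeal_eq_minorIdeal {D : KnotDiagram} {ι κ : Type} [Fintype κ]
    {A : Matrix ι κ ℤ[T;T⁻¹]} (e : SolutionIso (coloringSystem D.word) (matrixSystem A)) (m : ℕ) :
    D.alexanderIdeal m = minorIdeal A (Fintype.card κ + 1 - m) := by
  have hrot : D.word.rotate 1 ~r D.word := List.IsRotated.symm ⟨1, rfl⟩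
  obtain ⟨r⟩ := nonempty_solutionIso_of_isRotated hrot
  rw [KnotDiagram.alexanderIdeal, min_eq_right (Fintype.card_subtype_le _)]
  exact ((coloringIso D).symm.trans (r.trans e)).minorIdeal_eq m

end Alexander

section Faces

theorem eq_of_finRotate_invariant {α : Type*} {n : ℕ} {g : Fin n → α}
    (hg : ∀ j, g (finRotate n j) = g j) (i j : Fin n) : g i = g j := by
  have eq_zero (k : ℕ) (hk : k < n) : g ⟨k, hk⟩ = g ⟨0, by omega⟩ := by
    induction k with
    | zero => rfl
    | succ k ih =>
      rw [← ih (by omega), ← hg ⟨k, by omega⟩]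
      congr 1
      ext
      rw [val_finRotate]
      exact (Nat.mod_eq_of_lt hk).symm
  rw [eq_zero i i.2, eq_zero j j.2]

theorem Meets.symm {w : List Letter} {i k : Fin w.length} (h : Meets w i k) : Meets w k i :=
  ⟨h.1.symm, h.2.symm⟩

variable {w : List Letter} {j e : Fin w.length}

theorem IsGaussWord.get_eq_mate (hw : IsGaussWord w) (h : Meets w j e) :
    w.get e = (w.get j).mate := by
  obtain ⟨k, hk, meets_iff⟩ := hw.exists_get_eq_mate j
  rw [(meets_iff e).1 h, hk]

theorem IsGaussWord.fromRight_iff (hw : IsGaussWord w) (h : Meets w j e) :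
    FromRight w e ↔ ¬ FromRight w j := by
  unfold FromRight
  rw [hw.get_eq_mate h]
  unfold Letter.mate
  cases (w.get j).isOver <;> cases (w.get j).isPos <;> simp

theorem IsGaussWord.exists_meets_finRotate (hw : IsGaussWord w) (j : Fin w.length) :
    ∃ e, Meets w (finRotate _ j) (finRotate _ e) := by
  obtain ⟨k, -, meets_iff⟩ := hw.exists_get_eq_mate (finRotate _ j)
  exact ⟨(finRotate _).symm k, by rw [Equiv.apply_symm_apply, meets_iff]⟩

/-- The face at the left of a dart. -/
def faceAt (d : Fin w.length × Bool) : Face w := Quot.mk _ d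

-- Each crossing has four corners, and each corner identifies the two darts that bound it.
theorem IsGaussWord.faceAt_eq (hw : IsGaussWord w)
    (h : Meets w (finRotate _ j) (finRotate _ e)) (hr : FromRight w (finRotate _ j)) :
    faceAt (j, true) = faceAt (finRotate _ e, true) ∧
    faceAt (finRotate _ e, false) = faceAt (finRotate _ j, true) ∧
    faceAt (e, true) = faceAt (j, false) ∧
    faceAt (finRotate _ j, false) = faceAt (e, false) := by
  have hr' : ¬ FromRight w (finRotate _ e) := fun h' => (hw.fromRight_iff h).1 h' hr
  exact ⟨Quot.sound (.fwd_fwd _ _ h hr), Quot.sound (.bwd_fwd _ _ h.symm hr'),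
    Quot.sound (.fwd_bwd _ _ h.symm hr'), Quot.sound (.bwd_bwd _ _ h hr)⟩

/-- The coboundary modulo two of a function on the faces: the edge `i` receives the sum of the
values on the two faces that it separates. -/
def coboundary (w : List Letter) : (Face w → ZMod 2) →ₗ[ZMod 2] (Fin w.length → ZMod 2) where
  toFun h i := h (faceAt (i, true)) + h (faceAt (i, false))
  map_add' h h' := by ext i; simp only [Pi.add_apply]; ring
  map_smul' r h := by ext i; simp only [Pi.smul_apply, smul_eq_mul, RingHom.id_apply]; ring

theorem coboundary_apply (h : Face w → ZMod 2) (i : Fin w.length) :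
    coboundary w h i = h (faceAt (i, true)) + h (faceAt (i, false)) := rfl

/-- The cycles modulo two of the diagram, regarded as a graph with four edges at each crossing. -/
def cycles (w : List Letter) : Submodule (ZMod 2) (Fin w.length → ZMod 2) where
  carrier := {f | ∀ j e, Meets w (finRotate _ j) (finRotate _ e) →
    f j + f (finRotate _ j) + f e + f (finRotate _ e) = 0}
  add_mem' {f g} hf hg j e h := by
    simp only [Pi.add_apply]
    linear_combination hf j e h + hg j e h
  zero_mem' := by intro j e _; simp
  smul_mem' r f hf j e h := by
    simp only [Pi.smul_apply, smul_eq_mul]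
    linear_combination r * hf j e h

theorem coboundary_mem_cycles (hw : IsGaussWord w) (h : Face w → ZMod 2) :
    coboundary w h ∈ cycles w := by
  have sum_eq_zero (j e) (hm : Meets w (finRotate _ j) (finRotate _ e))
      (hr : FromRight w (finRotate _ j)) :
      coboundary w h j + coboundary w h (finRotate _ j) + coboundary w h e +
        coboundary w h (finRotate _ e) = 0 := by
    obtain ⟨h₁, h₂, h₃, h₄⟩ := hw.faceAt_eq hm hr
    simp only [coboundary_apply, h₁, h₂, h₃, h₄]
    linear_combination (h (faceAt (finRotate _ e, true)) + h (faceAt (j, false)) +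
      h (faceAt (finRotate _ j, true)) + h (faceAt (e, false))) * CharTwo.two_eq_zero (R := ZMod 2)
  intro j e hm
  by_cases hr : FromRight w (finRotate _ j)
  · exact sum_eq_zero j e hm hr
  · rw [← sum_eq_zero e j hm.symm ((hw.fromRight_iff hm).2 hr)]
    ring

theorem apply_eq_of_coboundary_eq_zero (hw : IsGaussWord w) {h : Face w → ZMod 2}
    (hh : coboundary w h = 0) (x y : Face w) : h x = h y := by
  have left_eq_right (i) : h (faceAt (i, true)) = h (faceAt (i, false)) :=
    CharTwo.add_eq_zero.1 (congrFun hh i)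
  have rotate_eq (j) : h (faceAt (finRotate _ j, true)) = h (faceAt (j, true)) := by
    obtain ⟨e, hm⟩ := hw.exists_meets_finRotate j
    by_cases hr : FromRight w (finRotate _ j)
    · obtain ⟨h₁, h₂, -, -⟩ := hw.faceAt_eq hm hr
      rw [h₁, ← h₂, left_eq_right]
    · obtain ⟨h₁, -, h₃, -⟩ := hw.faceAt_eq hm.symm ((hw.fromRight_iff hm).2 hr)
      rw [← h₁, left_eq_right e, ← h₃]
  have eq_left (i b) : h (faceAt (i, b)) = h (faceAt (i, true)) := by
    cases b
    exacts [(left_eq_right i).symm, rfl]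
  obtain ⟨⟨i, b⟩, rfl⟩ := Quot.exists_rep x
  obtain ⟨⟨k, c⟩, rfl⟩ := Quot.exists_rep y
  exact (eq_left i b).trans ((eq_of_finRotate_invariant (g := fun i => h (faceAt (i, true)))
    rotate_eq i k).trans (eq_left k c).symm)

theorem finrank_ker_coboundary_le (hw : IsGaussWord w) :
    Module.finrank (ZMod 2) (LinearMap.ker (coboundary w)) ≤ 1 := by
  refine (Submodule.finrank_mono (t := Submodule.span (ZMod 2) {fun _ => 1}) fun h hh => ?_).trans
    ((finrank_span_le_card _).trans (by simp))
  rw [Submodule.mem_span_singleton]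
  rcases isEmpty_or_nonempty (Face w) with _ | ⟨⟨x⟩⟩
  · exact ⟨0, Subsingleton.elim _ _⟩
  · refine ⟨h x, funext fun y => ?_⟩
    rw [Pi.smul_apply, smul_eq_mul, mul_one, apply_eq_of_coboundary_eq_zero hw hh x y]

theorem IsGaussWord.two_mul_card_over_le (hw : IsGaussWord w) :
    2 * Fintype.card {i : Fin w.length // (w.get i).isOver = true} ≤ w.length := by
  choose μ hμ _ using hw.exists_get_eq_mate
  have mate_injective : Function.Injective Letter.mate := fun x y h => by
    simpa only [Letter.mate, Bool.not_not] using congrArg Letter.mate h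
  have card_over_le : Fintype.card {i : Fin w.length // (w.get i).isOver = true} ≤
      Fintype.card {i : Fin w.length // ¬ (w.get i).isOver = true} := by
    refine Fintype.card_le_of_injective (fun i => ⟨μ i.1, ?_⟩) fun i j hij => ?_
    · rw [hμ, Letter.mate, i.2]
      simp
    · refine Subtype.ext (hw.nodup.injective_get (mate_injective ?_))
      rw [← hμ, ← hμ, show μ i.1 = μ j.1 from congrArg Subtype.val hij]
  have card_compl := Fintype.card_subtype_compl fun i : Fin w.length => (w.get i).isOver = true
  have card_le := Fintype.card_subtype_le fun i : Fin w.length => (w.get i).isOver = true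
  rw [Fintype.card_fin] at card_compl card_le
  omega

-- At the crossing of the passages `j` and `e`, a cycle that does not change along the upper strand
-- does not change along the lower one either.
theorem eq_zero_of_mem_cycles (hw : IsGaussWord w) {f : Fin w.length → ZMod 2} (hf : f ∈ cycles w)
    {i : Fin w.length} (hi : f i = 0)
    (hover : ∀ j, (w.get (finRotate _ j)).isOver = true → f (finRotate _ j) + f j = 0) :
    f = 0 := by
  have rotate_eq (j) : f (finRotate _ j) = f j := by
    refine CharTwo.add_eq_zero.1 ?_
    by_cases ho : (w.get (finRotate _ j)).isOver = true
    · exact hover j ho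
    · obtain ⟨e, hm⟩ := hw.exists_meets_finRotate j
      have hover_e := hover e (by rw [hw.get_eq_mate hm, Letter.mate]; simpa using ho)
      linear_combination hf j e hm - hover_e
  funext k
  rw [eq_of_finRotate_invariant rotate_eq k i, hi, Pi.zero_apply]

theorem finrank_cycles_le (hw : IsGaussWord w) (hne : 0 < w.length) :
    Module.finrank (ZMod 2) (cycles w) ≤
      1 + Fintype.card {i : Fin w.length // (w.get i).isOver = true} := by
  let Φ : cycles w →ₗ[ZMod 2] ZMod 2 × ({i : Fin w.length // (w.get i).isOver = true} → ZMod 2) :=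
    { toFun f := (f.1 ⟨0, hne⟩, fun i => f.1 i.1 + f.1 ((finRotate _).symm i.1))
      map_add' f g := by
        ext
        · simp
        · simp; ring
      map_smul' r f := by
        ext
        · simp
        · simp; ring }
  have injective : Function.Injective Φ := by
    rw [← LinearMap.ker_eq_bot, LinearMap.ker_eq_bot']
    intro f hf
    refine Subtype.ext (eq_zero_of_mem_cycles hw f.2 (congrArg Prod.fst hf) fun j hj => ?_)
    simpa only [Φ, LinearMap.coe_mk, AddHom.coe_mk, Equiv.symm_apply_apply, Prod.snd_zero,
      Pi.zero_apply] using congrFun (congrArg Prod.snd hf) ⟨_, hj⟩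
  exact (LinearMap.finrank_le_finrank_of_injective injective).trans (by simp)

-- The image of the coboundary has dimension at least `F - 1 = E - V + 1`, by sphericity, and the
-- space of cycles has dimension at most `1 + V`, where `E = 2 * V`.
theorem exists_coboundary_eq (hw : IsGaussWord w) (hs : IsSpherical w) (hne : 0 < w.length)
    {f : Fin w.length → ZMod 2} (hf : f ∈ cycles w) :
    ∃ h : Face w → ZMod 2, coboundary w h = f := by
  have euler : 2 * Nat.card (Face w) = w.length + 4 :=
    hs.resolve_left (List.ne_nil_of_length_pos hne)
  have : Finite (Face w) := Quot.finite _
  have : Fintype (Face w) := Fintype.ofFinite _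
  have rank_nullity := LinearMap.finrank_range_add_finrank_ker (coboundary w)
  rw [Module.finrank_fintype_fun_eq_card, ← Nat.card_eq_fintype_card] at rank_nullity
  have ker_le := finrank_ker_coboundary_le hw
  have cycles_le := finrank_cycles_le hw hne
  have over_le := hw.two_mul_card_over_le
  have range_le : LinearMap.range (coboundary w) ≤ cycles w := by
    rintro _ ⟨h, rfl⟩
    exact coboundary_mem_cycles hw h
  rwa [← Submodule.eq_of_le_of_finrank_le range_le (by omega)] at hf

theorem faceAt_left_of_fromRight (hm : Meets w (finRotate _ j) (finRotate _ e))
    (hr : FromRight w (finRotate _ j)) : faceAt (j, true) = faceAt (finRotate _ e, true) :=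
  Quot.sound (.fwd_fwd _ _ hm hr)

theorem coboundary_left_of_fromRight (hw : IsGaussWord w) (h : Face w → ZMod 2)
    (hm : Meets w (finRotate _ j) (finRotate _ e)) (hr : FromRight w (finRotate _ j)) :
    h (faceAt (finRotate _ j, true)) = h (faceAt (j, true)) + coboundary w h (finRotate _ e) := by
  obtain ⟨h₁, h₂, -, -⟩ := hw.faceAt_eq hm hr
  rw [coboundary_apply, h₁, h₂, CharTwo.add_cancel_left]

theorem coboundary_left_of_not_fromRight (hw : IsGaussWord w) (h : Face w → ZMod 2)
    (hm : Meets w (finRotate _ j) (finRotate _ e)) (hr : ¬ FromRight w (finRotate _ j)) :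
    h (faceAt (finRotate _ j, true)) = h (faceAt (j, true)) + coboundary w h e := by
  obtain ⟨h₁, -, h₃, -⟩ := hw.faceAt_eq hm.symm ((hw.fromRight_iff hm).2 hr)
  rw [coboundary_apply, h₁, h₃, add_comm (h (faceAt (finRotate _ j, true))),
    CharTwo.add_cancel_left]

end Faces

section FaceRotation

theorem FaceStep.map {w w' : List Letter} (e : Fin w.length ≃ Fin w'.length)
    (hget : ∀ i, w'.get (e i) = w.get i) (hrot : ∀ i, e (finRotate _ i) = finRotate _ (e i))
    {d d' : Fin w.length × Bool} (h : FaceStep w d d') :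
    FaceStep w' (e d.1, d.2) (e d'.1, d'.2) := by
  have meets {i k} (h : Meets w i k) : Meets w' (e i) (e k) :=
    ⟨e.injective.ne h.1, by rw [hget, hget]; exact h.2⟩
  have fromRight_iff (i) : FromRight w' (e i) ↔ FromRight w i := by
    unfold FromRight
    rw [hget]
  cases h with
  | fwd_fwd i k hm hr => exact .fwd_fwd _ _ (hrot i ▸ meets hm) (hrot i ▸ (fromRight_iff _).2 hr)
  | fwd_bwd i k hm hr =>
    exact .fwd_bwd _ _ (hrot i ▸ hrot k ▸ meets hm) (hrot i ▸ mt (fromRight_iff _).1 hr)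
  | bwd_bwd i k hm hr => exact .bwd_bwd _ _ (hrot k ▸ meets hm) ((fromRight_iff _).2 hr)
  | bwd_fwd i k hm hr => exact .bwd_fwd _ _ (meets hm) (mt (fromRight_iff _).1 hr)

theorem card_face_rotate_one (w : List Letter) :
    Nat.card (Face (w.rotate 1)) = Nat.card (Face w) := by
  let e : Fin (w.rotate 1).length ≃ Fin w.length :=
    (finCongr (List.length_rotate w 1)).trans (finRotate _)
  have get_eq (i) : w.get (e i) = (w.rotate 1).get i :=
    (getElem_rotate_one (finCongr (List.length_rotate w 1) i).2).symm
  have rotate_eq (i) : e (finRotate _ i) = finRotate _ (e i) := by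
    change finRotate _ (finCongr _ _) = finRotate _ (finRotate _ (finCongr _ _))
    congr 1
    ext
    rw [val_finRotate, finCongr_apply, finCongr_apply, Fin.val_cast, Fin.val_cast, val_finRotate]
    exact congrArg _ (List.length_rotate w 1)
  refine Nat.card_congr (Quot.congr (e.prodCongr (Equiv.refl Bool)) fun d d' => ⟨?_, fun h => ?_⟩)
  · exact fun h => h.map e get_eq rotate_eq
  · simpa using h.map e.symm (fun i => by rw [← get_eq, e.apply_symm_apply]) fun i => by
      rw [e.symm_apply_eq, rotate_eq, e.apply_symm_apply]

theorem IsSpherical.of_isRotated {w w' : List Letter} (h : w ~r w') (hw : IsSpherical w) :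
    IsSpherical w' := by
  obtain ⟨n, rfl⟩ := h
  induction n with
  | zero => rwa [List.rotate_zero]
  | succ n ih =>
    rw [← List.rotate_rotate]
    refine ih.imp (fun h => by rw [h, List.rotate_nil]) fun h => ?_
    rw [card_face_rotate_one, h, List.length_rotate (w.rotate n) 1]

theorem IsGaussWord.of_isRotated {w w' : List Letter} (h : w ~r w') (hw : IsGaussWord w) :
    IsGaussWord w' where
  nodup := h.nodup_iff.1 hw.nodup
  mate_mem x hx := h.mem_iff.1 (hw.mate_mem x (h.mem_iff.2 hx))
  eq_or_eq_mate x hx y hy := hw.eq_or_eq_mate x (h.mem_iff.2 hx) y (h.mem_iff.2 hy)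

end FaceRotation

section Blocks

/-- The word consists of `L` blocks of two letters; the blocks `i` and `τ i` are the two strands of
a matched pair. The block `i` passes first through the crossing `lab i`, above if and only if
`o i = true`, and then through the crossing `lab (τ i)`; both have the sign `s i`. -/
structure IsBlockWord (w : List Letter) (L : ℕ) (lab : Fin L → ℕ) (τ : Fin L → Fin L)
    (o s : Fin L → Bool) : Prop where
  length_eq : w.length = 2 * L
  get_even : ∀ (i : Fin L) (k : Fin w.length), (k : ℕ) = 2 * i → w.get k = ⟨lab i, o i, s i⟩
  get_odd : ∀ (i : Fin L) (k : Fin w.length), (k : ℕ) = 2 * i + 1 →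
    w.get k = ⟨lab (τ i), !o i, s i⟩
  lab_injective : Function.Injective lab
  partner_partner : ∀ i, τ (τ i) = i
  partner_ne : ∀ i, τ i ≠ i
  over_partner : ∀ i, o (τ i) = o i
  sign_partner : ∀ i, s (τ i) = s i

variable {w : List Letter} {L : ℕ} {lab : Fin L → ℕ} {τ : Fin L → Fin L} {o s : Fin L → Bool}

namespace IsBlockWord

/-- The position of the first letter of a block; as an edge, the one inside the block. -/
def fst (hB : IsBlockWord w L lab τ o s) (i : Fin L) : Fin w.length :=
  ⟨2 * i, by have := hB.length_eq; omega⟩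

/-- The position of the second letter of a block; as an edge, the one that leaves the block. -/
def snd (hB : IsBlockWord w L lab τ o s) (i : Fin L) : Fin w.length :=
  ⟨2 * i + 1, by have := hB.length_eq; omega⟩

/-- The edge that leads to a block. -/
def incoming (hB : IsBlockWord w L lab τ o s) (i : Fin L) : Fin w.length :=
  (finRotate _).symm (hB.fst i)

theorem finRotate_incoming (hB : IsBlockWord w L lab τ o s) (i : Fin L) :
    finRotate _ (hB.incoming i) = hB.fst i :=
  Equiv.apply_symm_apply _ _

theorem finRotate_fst (hB : IsBlockWord w L lab τ o s) (i : Fin L) :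
    finRotate _ (hB.fst i) = hB.snd i := by
  ext
  rw [val_finRotate]
  exact Nat.mod_eq_of_lt (hB.snd i).2

theorem incoming_eq_snd (hB : IsBlockWord w L lab τ o s) {i k : Fin L} (h : (k : ℕ) = i + 1) :
    hB.incoming k = hB.snd i := by
  rw [incoming, Equiv.symm_apply_eq]
  ext
  have hk := (hB.fst k).2
  rw [val_finRotate]
  simp only [fst, snd] at hk ⊢
  rw [show 2 * (i : ℕ) + 1 + 1 = 2 * k by omega, Nat.mod_eq_of_lt hk]

theorem eq_fst_or_eq_snd (hB : IsBlockWord w L lab τ o s) (k : Fin w.length) :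
    (∃ i, k = hB.fst i) ∨ ∃ i, k = hB.snd i := by
  have hlen := hB.length_eq
  have hk : (k : ℕ) / 2 < L := by omega
  rcases Nat.mod_two_eq_zero_or_one k with h | h
  · exact Or.inl ⟨⟨k / 2, hk⟩, Fin.ext (show (k : ℕ) = 2 * (k / 2) by omega)⟩
  · exact Or.inr ⟨⟨k / 2, hk⟩, Fin.ext (show (k : ℕ) = 2 * (k / 2) + 1 by omega)⟩

theorem fst_ne_snd (hB : IsBlockWord w L lab τ o s) (i k : Fin L) : hB.fst i ≠ hB.snd k := by
  intro h
  have : 2 * (i : ℕ) = 2 * (k : ℕ) + 1 := congrArg Fin.val h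
  omega

theorem fst_inj (hB : IsBlockWord w L lab τ o s) {i k : Fin L} :
    hB.fst i = hB.fst k ↔ i = k := by
  simp only [fst, Fin.ext_iff]
  omega

theorem snd_inj (hB : IsBlockWord w L lab τ o s) {i k : Fin L} :
    hB.snd i = hB.snd k ↔ i = k := by
  simp only [snd, Fin.ext_iff]
  omega

theorem get_fst (hB : IsBlockWord w L lab τ o s) (i : Fin L) :
    w.get (hB.fst i) = ⟨lab i, o i, s i⟩ :=
  hB.get_even i _ rfl

theorem get_snd (hB : IsBlockWord w L lab τ o s) (i : Fin L) :
    w.get (hB.snd i) = ⟨lab (τ i), !o i, s i⟩ :=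
  hB.get_odd i _ rfl

theorem meets_fst (hB : IsBlockWord w L lab τ o s) (i : Fin L) :
    Meets w (hB.fst i) (hB.snd (τ i)) := by
  refine ⟨hB.fst_ne_snd _ _, ?_⟩
  rw [hB.get_fst, hB.get_snd, hB.partner_partner]

theorem meets_snd (hB : IsBlockWord w L lab τ o s) (i : Fin L) :
    Meets w (hB.snd i) (hB.fst (τ i)) := by
  simpa only [hB.partner_partner] using (hB.meets_fst (τ i)).symm

theorem fromRight_fst (hB : IsBlockWord w L lab τ o s) (i : Fin L) :
    FromRight w (hB.fst i) ↔ o i = s i := by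
  unfold FromRight
  rw [hB.get_fst]

theorem fromRight_snd (hB : IsBlockWord w L lab τ o s) (i : Fin L) :
    FromRight w (hB.snd i) ↔ o i ≠ s i := by
  unfold FromRight
  rw [hB.get_snd]
  cases o i <;> cases s i <;> simp

theorem over_partner_eq_sign_iff (hB : IsBlockWord w L lab τ o s) (i : Fin L) :
    o (τ i) = s (τ i) ↔ o i = s i := by
  rw [hB.over_partner, hB.sign_partner]

section LeftFaces

variable (h : Face w → ZMod 2) {i : Fin L}

theorem meets_incoming (hB : IsBlockWord w L lab τ o s) (i : Fin L) :
    Meets w (finRotate _ (hB.incoming i)) (finRotate _ (hB.fst (τ i))) := by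
  rw [finRotate_incoming, finRotate_fst]
  exact hB.meets_fst i

theorem meets_finRotate_fst (hB : IsBlockWord w L lab τ o s) (i : Fin L) :
    Meets w (finRotate _ (hB.fst i)) (finRotate _ (hB.incoming (τ i))) := by
  rw [finRotate_incoming, finRotate_fst]
  exact hB.meets_snd i

theorem faceAt_incoming (hB : IsBlockWord w L lab τ o s) (hi : o i = s i) :
    faceAt (hB.incoming i, true) = faceAt (hB.snd (τ i), true) := by
  rw [← finRotate_fst]
  exact faceAt_left_of_fromRight (hB.meets_incoming i)
    (by rwa [finRotate_incoming, fromRight_fst])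

theorem faceAt_fst (hB : IsBlockWord w L lab τ o s) (hi : o i ≠ s i) :
    faceAt (hB.fst i, true) = faceAt (hB.fst (τ i), true) := by
  have := faceAt_left_of_fromRight (hB.meets_finRotate_fst i)
    (by rwa [finRotate_fst, fromRight_snd])
  rwa [finRotate_incoming] at this

theorem left_fst_of_eq (hB : IsBlockWord w L lab τ o s) (hw : IsGaussWord w) (hi : o i = s i) :
    h (faceAt (hB.fst i, true)) =
      h (faceAt (hB.incoming i, true)) + coboundary w h (hB.snd (τ i)) := by
  have := coboundary_left_of_fromRight hw h (hB.meets_incoming i)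
    (by rwa [finRotate_incoming, fromRight_fst])
  rwa [finRotate_incoming, finRotate_fst] at this

theorem left_fst_of_ne (hB : IsBlockWord w L lab τ o s) (hw : IsGaussWord w) (hi : o i ≠ s i) :
    h (faceAt (hB.fst i, true)) =
      h (faceAt (hB.incoming i, true)) + coboundary w h (hB.fst (τ i)) := by
  have := coboundary_left_of_not_fromRight hw h (hB.meets_incoming i)
    (by rwa [finRotate_incoming, fromRight_fst])
  rwa [finRotate_incoming] at this

theorem left_snd_of_eq (hB : IsBlockWord w L lab τ o s) (hw : IsGaussWord w) (hi : o i = s i) :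
    h (faceAt (hB.snd i, true)) =
      h (faceAt (hB.fst i, true)) + coboundary w h (hB.incoming (τ i)) := by
  have := coboundary_left_of_not_fromRight hw h (hB.meets_finRotate_fst i)
    (by rw [finRotate_fst, fromRight_snd]; exact fun hne => hne hi)
  rwa [finRotate_fst] at this

theorem left_snd_of_ne (hB : IsBlockWord w L lab τ o s) (hw : IsGaussWord w) (hi : o i ≠ s i) :
    h (faceAt (hB.snd i, true)) =
      h (faceAt (hB.fst i, true)) + coboundary w h (hB.fst (τ i)) := by
  have := coboundary_left_of_fromRight hw h (hB.meets_finRotate_fst i)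
    (by rwa [finRotate_fst, fromRight_snd])
  rwa [finRotate_fst, finRotate_incoming] at this

theorem left_snd_eq_left_incoming_add (hB : IsBlockWord w L lab τ o s) (hw : IsGaussWord w)
    (i : Fin L) :
    h (faceAt (hB.snd i, true)) = h (faceAt (hB.incoming i, true)) +
      if o i = s i then coboundary w h (hB.incoming (τ i)) + coboundary w h (hB.snd (τ i))
      else 0 := by
  split_ifs with hi
  · rw [hB.left_snd_of_eq h hw hi, hB.left_fst_of_eq h hw hi]
    ring
  · rw [hB.left_snd_of_ne h hw hi, hB.left_fst_of_ne h hw hi, CharTwo.add_cancel_right, add_zero]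

end LeftFaces

end IsBlockWord

/-- The indicator of the edges that follow the block `p` and precede the block `τ p`. The two ends
of this arc lie at the same crossing, so that it is a cycle. -/
def arcCycle (w : List Letter) (τ : Fin L → Fin L) (p : Fin L) (e : Fin w.length) : ZMod 2 :=
  if 2 * (p : ℕ) + 1 ≤ e ∧ (e : ℕ) < 2 * (τ p : ℕ) then 1 else 0

namespace IsBlockWord

theorem arcCycle_add_arcCycle_finRotate (hB : IsBlockWord w L lab τ o s) {p : Fin L} (hp : p < τ p)
    (j : Fin w.length) : arcCycle w τ p j + arcCycle w τ p (finRotate _ j) =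
      if finRotate _ j = hB.snd p ∨ finRotate _ j = hB.fst (τ p) then 1 else 0 := by
  have hlen := hB.length_eq
  have hτ := (τ p).2
  have hj := j.2
  rw [Fin.lt_def] at hp
  simp only [Fin.ext_iff, fst, snd, arcCycle, val_finRotate]
  rcases Nat.lt_or_ge (j + 1) w.length with h | h
  · rw [Nat.mod_eq_of_lt h]
    split_ifs <;> first | omega | decide
  · rw [show (j : ℕ) + 1 = w.length by omega, Nat.mod_self, if_neg (by omega), if_neg (by omega),
      if_neg (by omega), add_zero]

theorem arcCycle_mem_cycles (hB : IsBlockWord w L lab τ o s) (hw : IsGaussWord w)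
    {p : Fin L} (hp : p < τ p) : arcCycle w τ p ∈ cycles w := by
  intro j e hm
  rw [add_assoc, hB.arcCycle_add_arcCycle_finRotate hp, hB.arcCycle_add_arcCycle_finRotate hp]
  have end_of_meets {a b : Fin w.length} (hab : Meets w a b)
      (ha : a = hB.snd p ∨ a = hB.fst (τ p)) : b = hB.snd p ∨ b = hB.fst (τ p) := by
    obtain ⟨k, -, meets_iff⟩ := hw.exists_get_eq_mate a
    rw [(meets_iff b).1 hab]
    rcases ha with rfl | rfl
    · exact Or.inr ((meets_iff _).1 (hB.meets_snd p)).symm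
    · exact Or.inl ((meets_iff _).1 (hB.meets_snd p).symm).symm
  by_cases h : finRotate _ j = hB.snd p ∨ finRotate _ j = hB.fst (τ p)
  · rw [if_pos h, if_pos (end_of_meets hm h), CharTwo.add_self_eq_zero]
  · rw [if_neg h, if_neg (mt (end_of_meets hm.symm) h), add_zero]

theorem arcCycle_incoming_add_arcCycle_snd (hB : IsBlockWord w L lab τ o s) {p : Fin L}
    (hp : p < τ p) (i : Fin L) :
    arcCycle w τ p (hB.incoming i) + arcCycle w τ p (hB.snd i) =
      if i = p ∨ i = τ p then 1 else 0 := by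
  have at_fst := hB.arcCycle_add_arcCycle_finRotate hp (hB.incoming i)
  have at_snd := hB.arcCycle_add_arcCycle_finRotate hp (hB.fst i)
  simp only [finRotate_incoming, hB.fst_inj, hB.fst_ne_snd, false_or] at at_fst
  simp only [finRotate_fst, hB.snd_inj, (hB.fst_ne_snd _ _).symm, or_false] at at_snd
  have sum_eq : arcCycle w τ p (hB.incoming i) + arcCycle w τ p (hB.snd i) =
      (if i = τ p then 1 else 0) + (if i = p then 1 else 0) := by
    rw [← at_fst, ← at_snd, add_assoc, CharTwo.add_cancel_left]
  rw [sum_eq]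
  split_ifs with hiτ hip
  all_goals first | omega | simp_all

theorem left_snd_eq_left_incoming_of_coboundary_eq_arcCycle (hB : IsBlockWord w L lab τ o s)
    (hw : IsGaussWord w) {p i : Fin L} (hp : p < τ p) (hpi : p ≠ i) {h : Face w → ZMod 2}
    (hh : coboundary w h = arcCycle w τ p) :
    h (faceAt (hB.snd i, true)) =
      h (faceAt (hB.incoming i, true)) + if o p = s p ∧ i = τ p then 1 else 0 := by
  have partner_ne : τ i ≠ τ p := fun h => hpi.symm (by
    rw [← hB.partner_partner i, h, hB.partner_partner])
  have partner_eq_iff : τ i = p ↔ i = τ p :=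
    ⟨fun h => by rw [← h, hB.partner_partner], fun h => by rw [h, hB.partner_partner]⟩
  have side_iff : (o i = s i ∧ i = τ p) ↔ (o p = s p ∧ i = τ p) :=
    and_congr_left fun h => by rw [h, hB.over_partner_eq_sign_iff]
  rw [hB.left_snd_eq_left_incoming_add h hw i, hh, hB.arcCycle_incoming_add_arcCycle_snd hp]
  simp only [partner_ne, or_false, partner_eq_iff, ← ite_and, side_iff]

-- Travelling from the block `q` to the block `τ q`, one crosses the arc of `p` only at `τ p`.
theorem left_incoming_partner (hB : IsBlockWord w L lab τ o s) (hw : IsGaussWord w)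
    {p q : Fin L} (hpq : p < q) (hqp : q < τ p) (hpp : τ p < τ q) {h : Face w → ZMod 2}
    (hh : coboundary w h = arcCycle w τ p) :
    h (faceAt (hB.incoming (τ q), true)) =
      h (faceAt (hB.snd q, true)) + if o p = s p then 1 else 0 := by
  have up_to (r : ℕ) (hqr : (q : ℕ) ≤ r) (hr : r < (τ q : ℕ)) :
      h (faceAt (hB.snd ⟨r, hr.trans (τ q).2⟩, true)) =
        h (faceAt (hB.snd q, true)) + if o p = s p ∧ (τ p : ℕ) ≤ r then 1 else 0 := by
    induction r, hqr using Nat.le_induction with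
    | base => rw [if_neg fun hp => absurd hp.2 (not_le.2 hqp), add_zero]
    | succ r hqr ih =>
      rw [hB.left_snd_eq_left_incoming_of_coboundary_eq_arcCycle hw (hpq.trans hqp)
          (Fin.ne_of_lt (Fin.lt_def.2 (by simp only; omega))) hh,
        hB.incoming_eq_snd (i := ⟨r, by omega⟩) rfl, ih (by omega), add_assoc]
      congr 1
      simp only [Fin.ext_iff]
      by_cases hp : o p = s p
      · simp only [hp, true_and]
        split_ifs <;> first | omega | simp
      · simp only [hp, false_and, if_false, add_zero]
  have at_last := up_to (τ q - 1) (by omega) (by omega)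
  simp only [show (τ p : ℕ) ≤ τ q - 1 by omega, and_true] at at_last
  rwa [← hB.incoming_eq_snd (k := τ q) (by simp only; omega)] at at_last

theorem over_eq_sign_iff_of_interlaced (hB : IsBlockWord w L lab τ o s) (hw : IsGaussWord w)
    (hs : IsSpherical w) {p q : Fin L} (hpq : p < q) (hqp : q < τ p) (hpp : τ p < τ q) :
    o p = s p ↔ o q ≠ s q := by
  obtain ⟨h, hh⟩ := exists_coboundary_eq hw hs (Fin.pos (hB.fst p))
    (hB.arcCycle_mem_cycles hw (hpq.trans hqp))
  have left_partner := hB.left_incoming_partner hw hpq hqp hpp hh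
  by_cases hq : o q = s q
  · rw [hB.faceAt_incoming ((hB.over_partner_eq_sign_iff q).2 hq), hB.partner_partner]
      at left_partner
    simpa [hq] using left_partner
  · have hq' : o (τ q) ≠ s (τ q) := mt (hB.over_partner_eq_sign_iff q).1 hq
    have arc_fst : arcCycle w τ p (hB.fst q) = 1 := if_pos (by simp only [fst]; omega)
    have arc_fst_partner : arcCycle w τ p (hB.fst (τ q)) = 0 := if_neg (by simp only [fst]; omega)
    have left_snd := hB.left_snd_of_ne h hw hq
    have left_fst := hB.left_fst_of_ne h hw hq'
    rw [hh, arc_fst_partner, add_zero, hB.faceAt_fst hq] at left_snd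
    rw [hh, hB.partner_partner, arc_fst, left_partner, ← left_snd, add_assoc] at left_fst
    by_contra hp
    rw [if_neg (by tauto)] at left_fst
    simp at left_fst

theorem between_partner (hB : IsBlockWord w L lab τ o s) (hw : IsGaussWord w)
    (hs : IsSpherical w) {i j : Fin L} (hij : o i = s i ↔ o j = s j) (hlt : i < j)
    (hgt : j < τ i) : i < τ j ∧ τ j < τ i := by
  have hi : τ j ≠ i := fun h => hgt.ne (by rw [← h, hB.partner_partner])
  have hτi : τ j ≠ τ i := fun h => hlt.ne' (by rw [← hB.partner_partner j, h, hB.partner_partner])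
  refine ⟨lt_of_not_ge fun h => ?_, lt_of_not_ge fun h => ?_⟩
  · have := hB.over_eq_sign_iff_of_interlaced hw hs (p := τ j) (q := i) (lt_of_le_of_ne h hi)
      (by rwa [hB.partner_partner]) (by rwa [hB.partner_partner])
    rw [hB.over_partner_eq_sign_iff] at this
    tauto
  · have := hB.over_eq_sign_iff_of_interlaced hw hs hlt hgt (lt_of_le_of_ne h hτi.symm)
    tauto

end IsBlockWord

/-- The number of times that the first strand of the block `j` is met on the way from the end of the
block `i` to the beginning of the block `τ i`, counted negatively if `τ i` precedes `i`. -/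
def crossCount (τ : Fin L → Fin L) (i j : Fin L) : ℤ :=
  (if j < τ i then 1 else 0) - (if j ≤ i then 1 else 0)

theorem IsBlockWord.crossCount_partner (hB : IsBlockWord w L lab τ o s) (hw : IsGaussWord w)
    (hs : IsSpherical w) {i j : Fin L} (hij : o i = s i ↔ o j = s j) :
    crossCount τ i (τ j) = crossCount τ i j := by
  have hi := hB.over_partner_eq_sign_iff i
  have hj := hB.over_partner_eq_sign_iff j
  have hττi := hB.partner_partner i
  have hττj := hB.partner_partner j
  have eq_iff : τ j = i ↔ j = τ i :=
    ⟨fun h => by rw [← h, hττj], fun h => by rw [h, hττi]⟩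
  have partner_eq_iff : τ j = τ i ↔ j = i :=
    ⟨fun h => by rw [← hττj, h, hττi], fun h => by rw [h]⟩
  have between_of (k : Fin L) (hk : o k = s k ↔ o j = s j) :
      (k < j ∧ j < τ k) ↔ (k < τ j ∧ τ j < τ k) :=
    ⟨fun h => hB.between_partner hw hs hk h.1 h.2, fun h => by
      simpa only [hττj] using hB.between_partner hw hs (hk.trans hj.symm) h.1 h.2⟩
  have between := between_of i hij
  have between' := between_of (τ i) (hi.trans hij)
  have hne := hB.partner_ne i
  rw [hττi] at between'
  unfold crossCount
  clear between_of hττi hττj hi hj hij hs hw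
  simp only [Ne, Fin.ext_iff, Fin.lt_def, Fin.le_def] at *
  split_ifs <;> omega

end Blocks

section Matched

variable {w : List Letter} {x y : Letter} {σ : ℕ → ℕ}

theorem Follows.of_isRotated {w' : List Letter} (h : w ~r w') (hf : Follows w x y) :
    Follows w' x y := by
  obtain ⟨u, hu⟩ := hf
  exact ⟨u, h.symm.trans hu⟩

theorem Follows.mem_left (hf : Follows w x y) : x ∈ w := by
  obtain ⟨u, hu⟩ := hf
  exact hu.mem_iff.2 List.mem_cons_self

theorem Follows.get_finRotate (hw : w.Nodup) (hf : Follows w x y) {k : Fin w.length}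
    (hk : w.get k = x) : w.get (finRotate _ k) = y := by
  obtain ⟨u, hu⟩ := hf
  obtain ⟨n, rfl⟩ := hu.symm
  have nodup : (x :: y :: u).Nodup := List.nodup_rotate.1 hw
  rw [List.get_eq_getElem, List.getElem_rotate] at hk ⊢
  have index_eq_zero : ((k : ℕ) + n) % (x :: y :: u).length = 0 :=
    nodup.getElem_inj_iff.1 (hk.trans (List.getElem_cons_zero (h := by simp)).symm)
  have add_one_mod (m l : ℕ) (hl : l = (x :: y :: u).length)
      (hm : (m + n) % (x :: y :: u).length = 0) :
      ((m + 1) % l + n) % (x :: y :: u).length = 1 := by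
    subst hl
    rw [Nat.mod_add_mod, add_right_comm, Nat.add_mod, hm]
    simp
  have index_eq_one : ((finRotate _ k : ℕ) + n) % (x :: y :: u).length = 1 := by
    rw [val_finRotate]
    exact add_one_mod _ _ (List.length_rotate _ _) index_eq_zero
  simp only [index_eq_one]
  rfl

theorem Follows.right_unique (hw : w.Nodup) {z : Letter} (hy : Follows w x y)
    (hz : Follows w x z) : y = z := by
  obtain ⟨k, hk⟩ := List.get_of_mem hy.mem_left
  exact (hy.get_finRotate hw hk).symm.trans (hz.get_finRotate hw hk)

theorem Follows.get_eq (hw : w.Nodup) (hf : Follows w x y) {k : Fin w.length}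
    (hk : w.get (finRotate _ k) = y) : w.get k = x := by
  obtain ⟨e, he⟩ := List.get_of_mem hf.mem_left
  rw [← he, (finRotate _).injective (hw.injective_get (hk.trans (hf.get_finRotate hw he).symm))]

theorem IsGaussWord.not_follows_of_follows (hw : IsGaussWord w) (hlabel : x.label ≠ y.label)
    (h : Follows w x y) : ¬ Follows w y x := by
  intro h'
  obtain ⟨u, hu⟩ := h
  cases u with
  | nil =>
    have mate_mem := hu.mem_iff.1 (hw.mate_mem x (hu.mem_iff.2 List.mem_cons_self))
    simp only [List.mem_cons, List.not_mem_nil, or_false] at mate_mem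
    exact mate_mem.elim (Letter.mate_ne x) fun h => hlabel (h ▸ rfl)
  | cons z v =>
    have follows_z : Follows w y z := ⟨v ++ [x], hu.trans ⟨1, by simp⟩⟩
    have nodup := hu.nodup_iff.1 hw.nodup
    rw [h'.right_unique hw.nodup follows_z] at nodup
    simp at nodup

/-- The letter `x` is the first one of a strand of a matched pair of the matching `σ`. -/
def IsInitial (w : List Letter) (σ : ℕ → ℕ) (x : Letter) : Prop :=
  Follows w x ⟨σ x.label, !x.isOver, x.isPos⟩

/-- The involution `σ` splits the crossings of the word into matched pairs. -/
def IsMatching (w : List Letter) (σ : ℕ → ℕ) : Prop :=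
  ∀ x ∈ w, σ (σ x.label) = x.label ∧ IsMatchedPair w x.label (σ x.label)

theorem IsMatching.of_isRotated {w' : List Letter} (h : w ~r w') (hσ : IsMatching w σ) :
    IsMatching w' σ := by
  intro x hx
  obtain ⟨involutive, hne, o, s, hfst, hsnd⟩ := hσ x (h.mem_iff.2 hx)
  exact ⟨involutive, hne, o, s, hfst.of_isRotated h, hsnd.of_isRotated h⟩

theorem IsMatching.not_isInitial_next (hσ : IsMatching w σ) (hw : IsGaussWord w)
    (hx : IsInitial w σ x) : ¬ IsInitial w σ ⟨σ x.label, !x.isOver, x.isPos⟩ := by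
  obtain ⟨involutive, hne, -⟩ := hσ x hx.mem_left
  unfold IsInitial
  rw [involutive, Bool.not_not]
  exact hw.not_follows_of_follows hne hx

-- Of the two letters of a crossing `a`, exactly one is initial; the other one is the second letter
-- of the strand that begins at the crossing `σ a`.
theorem IsMatching.exists_isInitial_iff (hσ : IsMatching w σ) (hw : IsGaussWord w) (hx : x ∈ w) :
    ∃ o s : Bool, IsInitial w σ ⟨σ x.label, o, s⟩ ∧
      ∀ y ∈ w, y.label = x.label →
        (IsInitial w σ y ↔ y = ⟨x.label, o, s⟩) ∧
        (¬ IsInitial w σ y ↔ y = ⟨x.label, !o, s⟩) := by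
  obtain ⟨involutive, -, o, s, hfst, hsnd⟩ := hσ x hx
  have partner : IsInitial w σ ⟨σ x.label, o, s⟩ := by
    unfold IsInitial
    rwa [involutive]
  have not_isInitial : ¬ IsInitial w σ ⟨x.label, !o, s⟩ := by
    simpa only [involutive] using hσ.not_isInitial_next hw partner
  have ne : (⟨x.label, o, s⟩ : Letter) ≠ ⟨x.label, !o, s⟩ := (Letter.mate_ne _).symm
  refine ⟨o, s, partner, fun y hy hlabel => ?_⟩
  rcases hw.eq_or_eq_mate _ hfst.mem_left y hy hlabel with rfl | rfl
  · exact ⟨iff_of_true hfst rfl, iff_of_false (not_not.2 hfst) ne⟩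
  · exact ⟨iff_of_false not_isInitial ne.symm, iff_of_true not_isInitial rfl⟩

theorem IsMatching.isInitial_partner (hσ : IsMatching w σ) (hw : IsGaussWord w)
    (hx : IsInitial w σ x) : IsInitial w σ ⟨σ x.label, x.isOver, x.isPos⟩ := by
  obtain ⟨o, s, partner, isInitial_iff⟩ := hσ.exists_isInitial_iff hw hx.mem_left
  rwa [((isInitial_iff x hx.mem_left rfl).1.1 hx : x = ⟨x.label, o, s⟩)]

theorem IsMatching.eq_of_label_eq (hσ : IsMatching w σ) (hw : IsGaussWord w)
    (hx : IsInitial w σ x) (hy : IsInitial w σ y) (h : x.label = y.label) : x = y := by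
  obtain ⟨o, s, -, isInitial_iff⟩ := hσ.exists_isInitial_iff hw hx.mem_left
  rw [(isInitial_iff x hx.mem_left rfl).1.1 hx, (isInitial_iff y hy.mem_left h.symm).1.1 hy]

theorem IsMatching.isInitial_finRotate_iff (hσ : IsMatching w σ) (hw : IsGaussWord w)
    (k : Fin w.length) : IsInitial w σ (w.get (finRotate _ k)) ↔ ¬ IsInitial w σ (w.get k) := by
  refine ⟨fun h hk => ?_, fun hk => by_contra fun h => hk ?_⟩
  · rw [hk.get_finRotate hw.nodup rfl] at h
    exact hσ.not_isInitial_next hw hk h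
  · have mem := List.get_mem w (finRotate _ k)
    obtain ⟨o, s, partner, isInitial_iff⟩ := hσ.exists_isInitial_iff hw mem
    have follows := partner
    unfold IsInitial at follows
    rw [(hσ _ mem).1, ← (isInitial_iff _ mem rfl).2.1 h] at follows
    rwa [follows.get_eq hw.nodup rfl]

theorem finRotate_mk {n k : ℕ} (hk : k + 1 < n) :
    finRotate n ⟨k, by omega⟩ = ⟨k + 1, hk⟩ :=
  Fin.ext ((val_finRotate _).trans (Nat.mod_eq_of_lt hk))

theorem iff_even_of_finRotate_iff_not {n : ℕ} {p : Fin n → Prop}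
    (hp : ∀ k, p (finRotate n k) ↔ ¬ p k) (hn : 0 < n) (h0 : p ⟨0, hn⟩) (k : Fin n) :
    p k ↔ Even (k : ℕ) := by
  obtain ⟨k, hk⟩ := k
  induction k with
  | zero => exact iff_of_true h0 Even.zero
  | succ k ih =>
    have step := hp ⟨k, by omega⟩
    rw [finRotate_mk hk, ih] at step
    exact step.trans Nat.even_add_one.symm

theorem even_of_finRotate_iff_not {n : ℕ} {p : Fin n → Prop}
    (hp : ∀ k, p (finRotate n k) ↔ ¬ p k) (hn : 0 < n) (h0 : p ⟨0, hn⟩) : Even n := by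
  obtain ⟨n, rfl⟩ := Nat.exists_eq_add_one.2 hn
  have not_last : ¬ p (Fin.last n) := (hp _).1 (by rwa [finRotate_last])
  exact Nat.even_add_one.2 (mt (iff_even_of_finRotate_iff_not hp hn h0 (Fin.last n)).2 not_last)

theorem IsMatching.exists_isBlockWord (hσ : IsMatching w σ) (hw : IsGaussWord w)
    (hne : 0 < w.length) (h0 : IsInitial w σ (w.get ⟨0, hne⟩)) :
    ∃ (L : ℕ) (lab : Fin L → ℕ) (τ : Fin L → Fin L) (o s : Fin L → Bool),
      IsBlockWord w L lab τ o s := by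
  have isInitial_iff := iff_even_of_finRotate_iff_not (p := fun k => IsInitial w σ (w.get k))
    (hσ.isInitial_finRotate_iff hw) hne h0
  obtain ⟨L, hL⟩ := (even_of_finRotate_iff_not (p := fun k => IsInitial w σ (w.get k))
    (hσ.isInitial_finRotate_iff hw) hne h0).two_dvd
  let start (i : Fin L) : Fin w.length := ⟨2 * i, by omega⟩
  have isInitial_start (i) : IsInitial w σ (w.get (start i)) :=
    (isInitial_iff _).2 (even_two_mul _)
  have exists_partner (i) : ∃ j, w.get (start j) =
      ⟨σ (w.get (start i)).label, (w.get (start i)).isOver, (w.get (start i)).isPos⟩ := by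
    have partner := hσ.isInitial_partner hw (isInitial_start i)
    obtain ⟨k, hk⟩ := List.get_of_mem partner.mem_left
    obtain ⟨j, hj⟩ := ((isInitial_iff k).1 (hk ▸ partner)).two_dvd
    exact ⟨⟨j, by omega⟩, by rw [← hk]; exact congrArg w.get (Fin.ext hj.symm)⟩
  choose τ hτ using exists_partner
  have label_injective : Function.Injective fun i => (w.get (start i)).label := fun i j hij => by
    have := congrArg Fin.val (hw.nodup.injective_get
      (hσ.eq_of_label_eq hw (isInitial_start i) (isInitial_start j) hij))
    simp only [start] at this
    omega
  refine ⟨L, fun i => (w.get (start i)).label, τ, fun i => (w.get (start i)).isOver,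
    fun i => (w.get (start i)).isPos, hL, fun i k hk => ?_, fun i k hk => ?_, label_injective,
    fun i => label_injective ?_, fun i hi => ?_, fun i => by rw [hτ], fun i => by rw [hτ]⟩
  · rw [show k = start i from Fin.ext hk]
  · have : k = finRotate _ (start i) := by
      rw [finRotate_mk (by omega : 2 * (i : ℕ) + 1 < w.length)]
      exact Fin.ext hk
    rw [this, (isInitial_start i).get_finRotate hw.nodup rfl, hτ]
  · simp only [hτ]
    exact (hσ _ (List.get_mem w _)).1
  · have := congrArg Letter.label (hτ i)
    rw [hi] at this
    exact (hσ _ (List.get_mem w _)).2.1 this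

theorem KnotDiagram.IsMatched.exists_isBlockWord {D : KnotDiagram} (hD : D.IsMatched) :
    ∃ w, D.word ~r w ∧ ∃ (L : ℕ) (lab : Fin L → ℕ) (τ : Fin L → Fin L) (o s : Fin L → Bool),
      IsBlockWord w L lab τ o s := by
  obtain ⟨σ, hσ⟩ : ∃ σ, IsMatching D.word σ := hD
  rcases D.word.eq_nil_or_concat' with hword | ⟨v, x, hword⟩
  · refine ⟨[], by rw [hword], 0, Fin.elim0, Fin.elim0, Fin.elim0, Fin.elim0, ?_⟩
    constructor <;> first | rfl | exact fun i => i.elim0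
  · obtain ⟨-, -, o, s, ⟨u, hu⟩, -⟩ := hσ x (by simp [hword])
    exact ⟨_, hu, (hσ.of_isRotated hu).exists_isBlockWord (D.isGaussWord.of_isRotated hu)
      (by simp) ⟨u, .refl _⟩⟩

end Matched

section BlockColoring

variable {w : List Letter} {L : ℕ} {lab : Fin L → ℕ} {τ : Fin L → Fin L} {o s : Fin L → Bool}

theorem IsBlockWord.mem_labels_iff (hB : IsBlockWord w L lab τ o s) (a : ℕ) :
    a ∈ w.map Letter.label ↔ ∃ i, lab i = a := by
  rw [List.mem_map]
  constructor
  · rintro ⟨x, hx, rfl⟩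
    obtain ⟨k, rfl⟩ := List.get_of_mem hx
    rcases hB.eq_fst_or_eq_snd k with ⟨i, rfl⟩ | ⟨i, rfl⟩
    · exact ⟨i, by rw [hB.get_fst]⟩
    · exact ⟨τ i, by rw [hB.get_snd]⟩
  · rintro ⟨i, rfl⟩
    exact ⟨_, List.get_mem w (hB.fst i), by rw [hB.get_fst]⟩

variable {X : Type*}

/-- The index of the crossing which the block `i` passes on the lower side. -/
def lowerCrossing (τ : Fin L → Fin L) (o : Fin L → Bool) (i : Fin L) : Fin L :=
  if o i then τ i else i

/-- The color of the upper strand of the crossing with index `i`, computed from the colors `E k`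
in front of the blocks. -/
def upperColor (τ : Fin L → Fin L) (o : Fin L → Bool) (E : ℕ → X) (i : Fin L) : X :=
  if o i then E i else E (τ i + 1)

theorem upperColor_congr {E E' : ℕ → X} (h : ∀ k ≤ L, E k = E' k) :
    upperColor τ o E = upperColor τ o E' := by
  ext i
  rw [upperColor, upperColor, h i i.2.le, h (τ i + 1) (τ i).2]

theorem IsBlockWord.upperColor_lowerCrossing (hB : IsBlockWord w L lab τ o s) (E : ℕ → X)
    (i : Fin L) :
    upperColor τ o E (lowerCrossing τ o i) = if o i then E (τ i) else E (τ i + 1) := by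
  cases ho : o i <;> simp [upperColor, lowerCrossing, ho, hB.over_partner]

variable [AddCommGroup X]

/-- The sum of the first `k` members of a family. -/
def partialSum (d : Fin L → X) (k : ℕ) : X :=
  ∑ j ∈ Finset.univ.filter fun j : Fin L => (j : ℕ) < k, d j

theorem partialSum_zero (d : Fin L → X) : partialSum d 0 = 0 := by
  simp [partialSum]

theorem partialSum_succ (d : Fin L → X) (i : Fin L) :
    partialSum d (i + 1) = partialSum d i + d i := by
  have filter_eq : Finset.univ.filter (fun j : Fin L => (j : ℕ) < i + 1) =
      Finset.cons i (Finset.univ.filter fun j : Fin L => (j : ℕ) < i) (by simp) := by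
    ext j
    simp only [Finset.mem_filter_univ, Finset.mem_cons, Fin.ext_iff]
    omega
  rw [partialSum, filter_eq, Finset.sum_cons, add_comm, partialSum]

theorem eq_partialSum_sub {E : ℕ → X} (hE : E 0 = 0) {k : ℕ}
    (hk : k ≤ L) : E k = partialSum (fun i : Fin L => E (i + 1) - E i) k := by
  induction k with
  | zero => rw [hE, partialSum_zero]
  | succ k ih =>
    have succ := partialSum_succ (fun i : Fin L => E (i + 1) - E i) ⟨k, hk⟩
    rw [succ, ← ih (by omega)]
    abel

theorem IsBlockWord.partialSum_eq_zero (hB : IsBlockWord w L lab τ o s) {d : Fin L → X}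
    (hd : ∀ i, d (τ i) = -d i) : partialSum d L = 0 := by
  simp only [partialSum, Fin.is_lt, Finset.filter_true]
  exact Finset.sum_involution (fun i _ => τ i) (fun i _ => by rw [hd, add_neg_cancel])
    (fun i _ _ => hB.partner_ne i) (fun i _ => Finset.mem_univ _) fun i _ => hB.partner_partner i

/-- The colors of the upper strands for given changes of color along the blocks. -/
noncomputable def blockColoring (lab : Fin L → ℕ) (τ : Fin L → Fin L) (o : Fin L → Bool)
    (d : Fin L → X) : ℕ → X :=
  Function.extend lab (upperColor τ o (partialSum d)) 0

theorem IsBlockWord.blockColoring_lab (hB : IsBlockWord w L lab τ o s) (d : Fin L → X)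
    (i : Fin L) : blockColoring lab τ o d (lab i) = upperColor τ o (partialSum d) i :=
  hB.lab_injective.extend_apply _ _ _

variable [Module ℤ[T;T⁻¹] X]

/-- The ratio of the change of color along a block and the difference of the colors between the
two blocks of a matched pair. -/
noncomputable def blockCoeff (o s : Bool) : ℤ[T;T⁻¹] :=
  if o then tPow (!s) - 1 else 1 - tPow s

/-- The coefficients of the linear relations between the changes of color along the blocks. -/
noncomputable def jumpCoeff (τ : Fin L → Fin L) (o s : Fin L → Bool) (i j : Fin L) : ℤ[T;T⁻¹] :=
  blockCoeff (o i) (s i) * crossCount τ i j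

theorem sum_jumpCoeff_smul (τ : Fin L → Fin L) (o s : Fin L → Bool) (d : Fin L → X) (i : Fin L) :
    ∑ j, jumpCoeff τ o s i j • d j =
      blockCoeff (o i) (s i) • (partialSum d (τ i) - partialSum d i - d i) := by
  simp only [jumpCoeff, mul_smul, ← Finset.smul_sum]
  rw [sub_sub, ← partialSum_succ, partialSum, partialSum, Finset.sum_filter, Finset.sum_filter,
    ← Finset.sum_sub_distrib]
  congr! 2 with j
  simp only [crossCount, Fin.lt_def, Fin.le_def, Nat.lt_succ_iff]
  split_ifs <;> simp

/-- The possible changes of color along the blocks of a block word. -/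
def jumpSystem (τ : Fin L → Fin L) (o s : Fin L → Bool) : System ℤ[T;T⁻¹] (Fin L) :=
  fun _ _ _ d => (∀ i, d (τ i) = -d i) ∧ ∀ i, d i = ∑ j, jumpCoeff τ o s i j • d j

theorem jump_relations_over_iff {s : Bool} {x x' d d' : X} :
    (d = (1 - tPow s) • (x' - x) ∧ d' = (1 - tPow s) • (x - x')) ↔
      d' = -d ∧ d = (tPow (!s) - 1) • (x' - x - d) := by
  have smul_iff : d = (tPow (!s) - 1) • (x' - x - d) ↔ d = (1 - tPow s) • (x' - x) := by
    have factor : tPow (!s) - 1 = tPow (!s) * (1 - tPow s) := by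
      rw [mul_sub, mul_one, mul_comm, tPow_mul_tPow_not]
    rw [factor, mul_smul, eq_comm, tPow_not_smul_eq_iff, ← sub_eq_zero, eq_comm (a := d),
      ← sub_eq_zero (b := d)]
    exact Eq.congr_left (by module)
  rw [smul_iff, and_comm]
  refine and_congr_left fun hd => ?_
  rw [show (1 - tPow s) • (x - x') = -((1 - tPow s) • (x' - x)) by module, ← hd]

theorem jump_relations_under_iff {s : Bool} {x x' d d' : X} :
    (d = (1 - tPow s) • (x' + d' - x) ∧ d' = (1 - tPow s) • (x + d - x')) ↔
      d' = -d ∧ d = (1 - tPow s) • (x' - x - d) := by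
  have smul_eq (hd' : d' = -d) : (1 - tPow s) • (x' + d' - x) = (1 - tPow s) • (x' - x - d) := by
    rw [hd']
    module
  constructor
  · rintro ⟨hd, hd'⟩
    have smul_add_eq : tPow s • (d' + d) = tPow s • (0 : X) := by
      calc tPow s • (d' + d)
          = d' - (1 - tPow s) • (x + d - x') + (d - (1 - tPow s) • (x' + d' - x)) := by module
        _ = tPow s • (0 : X) := by rw [← hd, ← hd']; module
    have neg : d' = -d := eq_neg_of_add_eq_zero_left (tPow_smul_inj.1 smul_add_eq)
    exact ⟨neg, hd.trans (smul_eq neg)⟩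
  · rintro ⟨hd', hd⟩
    refine ⟨hd.trans (smul_eq hd').symm, ?_⟩
    calc d' = -((1 - tPow s) • (x' - x - d)) := by rw [← hd, hd']
      _ = (1 - tPow s) • (x + d - x') := by module

theorem IsBlockWord.jumpSystem_iff (hB : IsBlockWord w L lab τ o s) {X : Type} [AddCommGroup X]
    [Module ℤ[T;T⁻¹] X] {d : Fin L → X} :
    jumpSystem τ o s X d ↔ ∀ i, d i = (1 - tPow (s i)) •
      (upperColor τ o (partialSum d) (lowerCrossing τ o i) - partialSum d i) := by
  have pair_iff (i) : (d i = (1 - tPow (s i)) •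
        (upperColor τ o (partialSum d) (lowerCrossing τ o i) - partialSum d i) ∧
      d (τ i) = (1 - tPow (s (τ i))) •
        (upperColor τ o (partialSum d) (lowerCrossing τ o (τ i)) - partialSum d (τ i))) ↔
      d (τ i) = -d i ∧ d i = ∑ j, jumpCoeff τ o s i j • d j := by
    rw [hB.upperColor_lowerCrossing, hB.upperColor_lowerCrossing, hB.sign_partner,
      hB.over_partner, hB.partner_partner, sum_jumpCoeff_smul]
    simp only [partialSum_succ]
    cases ho : o i
    · exact jump_relations_under_iff
    · exact jump_relations_over_iff
  exact ⟨fun h i => ((pair_iff i).2 ⟨h.1 i, h.2 i⟩).1, fun h =>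
    ⟨fun i => ((pair_iff i).1 ⟨h i, h _⟩).1, fun i => ((pair_iff i).1 ⟨h i, h _⟩).2⟩⟩

/-- The color in front of the block `k`. -/
noncomputable def blockColor (w : List Letter) (c : ℕ → X) (k : ℕ) : X :=
  endColor c (w.take (2 * k)) 0

theorem IsBlockWord.endColor_take_fst_succ (hB : IsBlockWord w L lab τ o s) (c : ℕ → X)
    (i : Fin L) : endColor c (w.take (2 * i + 1)) 0 =
      pass c (blockColor w c i) ⟨lab i, o i, s i⟩ := by
  rw [← hB.get_fst]
  exact endColor_take_succ c 0 (hB.fst i).2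

theorem IsBlockWord.blockColor_succ_eq_pass (hB : IsBlockWord w L lab τ o s) (c : ℕ → X)
    (i : Fin L) : blockColor w c (i + 1) =
      pass c (endColor c (w.take (2 * i + 1)) 0) ⟨lab (τ i), !o i, s i⟩ := by
  rw [← hB.get_snd]
  exact endColor_take_succ c 0 (hB.snd i).2

theorem IsBlockWord.blockColor_succ (hB : IsBlockWord w L lab τ o s) (c : ℕ → X) (i : Fin L) :
    blockColor w c (i + 1) = tPow (s i) • blockColor w c i +
      (1 - tPow (s i)) • c (lab (lowerCrossing τ o i)) := by
  rw [hB.blockColor_succ_eq_pass, hB.endColor_take_fst_succ]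
  cases ho : o i <;> simp [pass, lowerCrossing, ho]

theorem IsBlockWord.endColor_take_snd (hB : IsBlockWord w L lab τ o s) (c : ℕ → X) (i : Fin L) :
    endColor c (w.take (2 * i + 1)) 0 =
      if o i then blockColor w c i else blockColor w c (i + 1) := by
  split_ifs with ho
  · rw [hB.endColor_take_fst_succ, pass, if_pos ho]
  · rw [hB.blockColor_succ_eq_pass, pass, if_pos (by simp [ho])]

theorem IsBlockWord.runs_iff (hB : IsBlockWord w L lab τ o s) (c : ℕ → X) :
    Runs c w 0 0 ↔ blockColor w c L = 0 ∧
      ∀ i, c (lab i) = upperColor τ o (blockColor w c) i := by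
  rw [runs_iff_getElem, blockColor, ← hB.length_eq, List.take_length]
  refine and_congr_right fun _ => ⟨fun h i => ?_, fun h k hk hover => ?_⟩
  · cases ho : o i
    · have h_snd := h (2 * (τ i) + 1) (hB.snd (τ i)).2
      rw [show w[2 * (τ i : ℕ) + 1]'(hB.snd (τ i)).2 = _ from hB.get_snd (τ i),
        hB.partner_partner, hB.endColor_take_snd, hB.over_partner, ho] at h_snd
      simpa [upperColor, ho] using h_snd
    · have h_fst := h (2 * i) (hB.fst i).2
      rw [show w[2 * (i : ℕ)]'(hB.fst i).2 = _ from hB.get_fst i] at h_fst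
      simpa [upperColor, ho] using! h_fst ho
  · rcases hB.eq_fst_or_eq_snd ⟨k, hk⟩ with ⟨i, hi⟩ | ⟨i, hi⟩
    · obtain rfl : k = 2 * i := congrArg Fin.val hi
      rw [show w[2 * (i : ℕ)]'hk = _ from hB.get_fst i] at hover ⊢
      exact (h i).trans (if_pos hover)
    · obtain rfl : k = 2 * i + 1 := congrArg Fin.val hi
      rw [show w[2 * (i : ℕ) + 1]'hk = _ from hB.get_snd i] at hover ⊢
      have ho : o i = false := by simpa using hover
      simp [h, upperColor, hB.over_partner, hB.partner_partner, hB.endColor_take_snd, ho]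

/-- The changes of color along the blocks. -/
noncomputable def blockJumps (w : List Letter) (L : ℕ) (c : ℕ → X) (i : Fin L) : X :=
  blockColor w c (i + 1) - blockColor w c i

theorem blockColor_eq_partialSum (w : List Letter) (c : ℕ → X) :
    ∀ k ≤ L, blockColor w c k = partialSum (blockJumps w L c) k :=
  fun _ => eq_partialSum_sub rfl

end BlockColoring

section JumpIso

variable {w : List Letter} {L : ℕ} {lab : Fin L → ℕ} {τ : Fin L → Fin L} {o s : Fin L → Bool}
variable {X : Type} [AddCommGroup X] [Module ℤ[T;T⁻¹] X]

theorem IsBlockWord.jumpSystem_blockJumps (hB : IsBlockWord w L lab τ o s) {c : ℕ → X}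
    (hc : coloringSystem w X c) : jumpSystem τ o s X (blockJumps w L c) := by
  rw [hB.jumpSystem_iff]
  intro i
  rw [← upperColor_congr (blockColor_eq_partialSum w c), ← blockColor_eq_partialSum w c i i.2.le,
    ← ((hB.runs_iff c).1 hc.2).2, blockJumps, hB.blockColor_succ]
  module

theorem IsBlockWord.blockColoring_blockJumps (hB : IsBlockWord w L lab τ o s) {c : ℕ → X}
    (hc : coloringSystem w X c) : blockColoring lab τ o (blockJumps w L c) = c := by
  ext a
  by_cases ha : ∃ i, lab i = a
  · obtain ⟨i, rfl⟩ := ha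
    rw [hB.blockColoring_lab, ← upperColor_congr (blockColor_eq_partialSum w c),
      ((hB.runs_iff c).1 hc.2).2]
  · rw [blockColoring, Function.extend_apply' _ _ _ ha, hc.1 a (mt (hB.mem_labels_iff a).1 ha)]
    rfl

theorem IsBlockWord.blockColor_blockColoring (hB : IsBlockWord w L lab τ o s) {d : Fin L → X}
    (hd : jumpSystem τ o s X d) :
    ∀ k ≤ L, blockColor w (blockColoring lab τ o d) k = partialSum d k := by
  intro k hk
  induction k with
  | zero => exact (partialSum_zero d).symm
  | succ k ih =>
    have block := hB.blockColor_succ (blockColoring lab τ o d) ⟨k, hk⟩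
    have jump := hB.jumpSystem_iff.1 hd ⟨k, hk⟩
    have sum := partialSum_succ d ⟨k, hk⟩
    simp only at block sum jump
    rw [block, ih (by omega), hB.blockColoring_lab, sum, jump]
    module

theorem IsBlockWord.coloringSystem_blockColoring (hB : IsBlockWord w L lab τ o s)
    {d : Fin L → X} (hd : jumpSystem τ o s X d) :
    coloringSystem w X (blockColoring lab τ o d) := by
  have color_eq := hB.blockColor_blockColoring hd
  refine ⟨fun a ha => ?_, (hB.runs_iff _).2 ⟨?_, fun i => ?_⟩⟩
  · rw [hB.mem_labels_iff] at ha
    exact Function.extend_apply' _ _ _ ha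
  · rw [color_eq L le_rfl, hB.partialSum_eq_zero hd.1]
  · rw [upperColor_congr color_eq, hB.blockColoring_lab]

/-- A coloring of a block word is determined by the changes of color along the blocks. -/
noncomputable def IsBlockWord.jumpIso (hB : IsBlockWord w L lab τ o s) :
    SolutionIso (coloringSystem w) (jumpSystem τ o s) where
  toFun c := blockJumps w L c
  invFun d := blockColoring lab τ o d
  map_toFun φ c := by
    ext i
    simp only [Function.comp_apply, blockJumps, blockColor, map_sub, map_endColor, map_zero]
  map_invFun φ d := by
    rw [blockColoring, map_extend_zero]
    congr 1
    ext i
    simp only [Function.comp_apply, upperColor, partialSum, apply_ite φ, map_sum]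
  toFun_mem := hB.jumpSystem_blockJumps
  invFun_mem := hB.coloringSystem_blockColoring
  left_inv := hB.blockColoring_blockJumps
  right_inv {X _ _ d} hd := by
    ext i
    rw [blockJumps, hB.blockColor_blockColoring hd _ i.2.le, hB.blockColor_blockColoring hd _ i.2,
      partialSum_succ]
    abel

end JumpIso

section Symmetric

open LaurentPolynomial

variable {R : Type*} [CommRing R]

-- Modulo `t = t⁻¹` the substitution of `t⁻¹` for `t` becomes the identity.
theorem sub_invert_mem_span (r : R[T;T⁻¹]) :
    r - invert r ∈ Ideal.span {(T 1 - T (-1) : R[T;T⁻¹])} := by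
  set mk := Ideal.Quotient.mkₐ R (Ideal.span {(T 1 - T (-1) : R[T;T⁻¹])})
  have mk_T_one : mk (T 1) = mk (T (-1)) := Ideal.Quotient.eq.2 (Ideal.mem_span_singleton_self _)
  have mk_comp_invert : mk = mk.comp (invert : R[T;T⁻¹] ≃ₐ[R] R[T;T⁻¹]).toAlgHom := by
    refine AddMonoidAlgebra.algHom_ext' (MonoidHom.ext_mint ?_) (Subsingleton.elim _ _)
    simpa using! mk_T_one
  exact Ideal.Quotient.eq.1 (DFunLike.congr_fun mk_comp_invert r)

theorem sub_invert_mem_span_mul_span {S : Set R[T;T⁻¹]} (hS : ∀ r ∈ S, invert r = r) {r : R[T;T⁻¹]}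
    (hr : r ∈ Ideal.span S) :
    r - invert r ∈ Ideal.span {(T 1 - T (-1) : R[T;T⁻¹])} * Ideal.span S := by
  induction hr using Submodule.span_induction with
  | mem r hr => simp [hS r hr]
  | zero => simp
  | add r r' _ _ hr hr' =>
    rw [map_add, add_sub_add_comm]
    exact add_mem hr hr'
  | smul a r hr h =>
    have invert_mem : invert r ∈ Ideal.span S := by
      simpa using sub_mem hr (Ideal.mul_le_right h)
    rw [smul_eq_mul, map_mul, show a * r - invert a * invert r =
      a * (r - invert r) + (a - invert a) * invert r by ring]
    exact Ideal.add_mem _ (Ideal.mul_mem_left _ a h)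
      (Ideal.mul_mem_mul (sub_invert_mem_span a) invert_mem)

theorem T_one_sub_T_neg_one_ne_zero [Nontrivial R] : (T 1 - T (-1) : R[T;T⁻¹]) ≠ 0 := by
  intro h
  have := congrArg (fun p : R[T;T⁻¹] => p.coeff 1) h
  simp at this

theorem span_eq_top_of_one_add_T_mem [IsDomain R] {S : Set R[T;T⁻¹]}
    (hS : ∀ r ∈ S, invert r = r) (h : 1 + T 1 ∈ Ideal.span S) : Ideal.span S = ⊤ := by
  have mem_mul := sub_invert_mem_span_mul_span hS h
  rw [map_add, map_one, invert_T, add_sub_add_left_eq_sub, Ideal.mem_span_singleton_mul] at mem_mul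
  obtain ⟨q, hq, mul_eq⟩ := mem_mul
  rw [mul_eq_left₀ T_one_sub_T_neg_one_ne_zero] at mul_eq
  exact (Ideal.eq_top_iff_one _).2 (mul_eq ▸ hq)

theorem minorIdeal_eq_top_of_one_add_T_mem [IsDomain R] {ι κ : Type*} {A : Matrix ι κ R[T;T⁻¹]}
    (hA : ∀ i j, invert (A i j) = A i j) {k : ℕ} (h : 1 + T 1 ∈ minorIdeal A k) :
    minorIdeal A k = ⊤ := by
  refine span_eq_top_of_one_add_T_mem ?_ h
  rintro _ ⟨⟨p, q⟩, rfl⟩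
  rw [AlgEquiv.map_det]
  congr 1
  ext1 i j
  exact hA _ _

end Symmetric

section LeftBlocks

variable {w : List Letter} {L : ℕ} {lab : Fin L → ℕ} {τ : Fin L → Fin L} {o s : Fin L → Bool}

/-- The coefficients of the relations between the blocks at the left (those with `o i = s i`),
after elimination of the blocks at the right. -/
noncomputable def leftCoeff (τ : Fin L → Fin L) (o s : Fin L → Bool) (i k : Fin L) : ℤ[T;T⁻¹] :=
  ∑ j with o j ≠ s j, jumpCoeff τ o s i j * jumpCoeff τ o s j k

/-- The relations between the blocks at the left as a matrix: the first rows express that the two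
blocks of a matched pair have opposite changes of color. -/
noncomputable def leftMatrix (τ : Fin L → Fin L) (o s : Fin L → Bool) :
    Matrix ({i : Fin L // o i = s i} ⊕ {i : Fin L // o i = s i}) {i : Fin L // o i = s i}
      ℤ[T;T⁻¹] :=
  Matrix.of <| Sum.elim
    (fun i k => (if k = i then 1 else 0) + (if k.1 = τ i.1 then 1 else 0))
    (fun i k => (if k = i then 1 else 0) - leftCoeff τ o s i k)

theorem invert_tPow (s : Bool) : LaurentPolynomial.invert (tPow s) = tPow (!s) := by
  cases s <;> simp [tPow]

theorem invert_blockCoeff_mul_blockCoeff (s s' : Bool) :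
    LaurentPolynomial.invert (blockCoeff s s * blockCoeff (!s') s') =
      blockCoeff s s * blockCoeff (!s') s' := by
  cases s <;> cases s' <;> simp [blockCoeff, invert_tPow] <;> ring

-- `blockCoeff` is `±(t⁻¹ - 1)` at the left and `±(t - 1)` at the right.
theorem invert_leftCoeff {i : Fin L} (hi : o i = s i) (k : Fin L) :
    LaurentPolynomial.invert (leftCoeff τ o s i k) = leftCoeff τ o s i k := by
  rw [leftCoeff, map_sum]
  refine Finset.sum_congr rfl fun j hj => ?_
  rw [Finset.mem_filter_univ, ← Bool.eq_not] at hj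
  rw [jumpCoeff, jumpCoeff, mul_mul_mul_comm, hi, hj, ← Int.cast_mul, map_mul, map_intCast,
    invert_blockCoeff_mul_blockCoeff]

theorem invert_leftMatrix (i : {i : Fin L // o i = s i} ⊕ {i : Fin L // o i = s i})
    (k : {i : Fin L // o i = s i}) :
    LaurentPolynomial.invert (leftMatrix τ o s i k) = leftMatrix τ o s i k := by
  rcases i with i | i
  · simp only [leftMatrix, Matrix.of_apply, Sum.elim_inl, map_add]
    split_ifs <;> simp only [map_one, map_zero]
  · simp only [leftMatrix, Matrix.of_apply, Sum.elim_inr, map_sub, invert_leftCoeff i.2]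
    split_ifs <;> simp only [map_one, map_zero]

theorem IsBlockWord.left_partner_iff (hB : IsBlockWord w L lab τ o s) (i : Fin L) :
    o (τ i) = s (τ i) ↔ o i = s i := by
  rw [hB.over_partner, hB.sign_partner]

theorem IsBlockWord.jumpCoeff_partner_left (hB : IsBlockWord w L lab τ o s) {i j : Fin L}
    (hij : ¬(o j = s j ↔ o i = s i)) : jumpCoeff τ o s (τ i) j = -jumpCoeff τ o s i j := by
  have ne : j ≠ i := by
    rintro rfl
    exact hij Iff.rfl
  have ne_partner : j ≠ τ i := by
    rintro rfl
    exact hij (hB.left_partner_iff i)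
  have crossCount_neg : crossCount τ (τ i) j = -crossCount τ i j := by
    rw [crossCount, crossCount, hB.partner_partner]
    split_ifs <;> omega
  rw [jumpCoeff, hB.over_partner, hB.sign_partner, crossCount_neg, Int.cast_neg, mul_neg, jumpCoeff]

variable {X : Type} [AddCommGroup X] [Module ℤ[T;T⁻¹] X]

theorem IsBlockWord.sum_jumpCoeff_same_side (hB : IsBlockWord w L lab τ o s) (hw : IsGaussWord w)
    (hs : IsSpherical w) {d : Fin L → X} (hd : ∀ i, d (τ i) = -d i) (i : Fin L) :
    ∑ j with (o i = s i ↔ o j = s j), jumpCoeff τ o s i j • d j = 0 := by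
  refine Finset.sum_involution (fun j _ => τ j) (fun j hj => ?_) (fun j _ _ => hB.partner_ne j)
    (fun j hj => ?_) fun j _ => hB.partner_partner j
  · rw [Finset.mem_filter_univ] at hj
    rw [jumpCoeff, jumpCoeff, hB.crossCount_partner hw hs hj, hd, smul_neg, add_neg_cancel]
  · rw [Finset.mem_filter_univ] at hj ⊢
    exact hj.trans (hB.left_partner_iff j).symm

theorem IsBlockWord.sum_jumpCoeff_of_left (hB : IsBlockWord w L lab τ o s) (hw : IsGaussWord w)
    (hs : IsSpherical w) {d : Fin L → X} (hd : ∀ i, d (τ i) = -d i) {i : Fin L} (hi : o i = s i) :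
    ∑ j, jumpCoeff τ o s i j • d j = ∑ j with o j ≠ s j, jumpCoeff τ o s i j • d j := by
  have same_side := hB.sum_jumpCoeff_same_side hw hs hd i
  simp only [hi, true_iff] at same_side
  rw [← Finset.sum_filter_add_sum_filter_not _ fun j => o j = s j, same_side, zero_add]

theorem IsBlockWord.sum_jumpCoeff_of_right (hB : IsBlockWord w L lab τ o s) (hw : IsGaussWord w)
    (hs : IsSpherical w) {d : Fin L → X} (hd : ∀ i, d (τ i) = -d i) {i : Fin L} (hi : o i ≠ s i) :
    ∑ j, jumpCoeff τ o s i j • d j =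
      ∑ k : {k : Fin L // o k = s k}, jumpCoeff τ o s i k • d k := by
  have same_side := hB.sum_jumpCoeff_same_side hw hs hd i
  simp only [hi, false_iff] at same_side
  rw [← Finset.sum_filter_add_sum_filter_not _ fun j => o j = s j, same_side, add_zero,
    Finset.sum_subtype _ fun j => Finset.mem_filter_univ j]

/-- The changes of color along all blocks, computed from those at the left. -/
noncomputable def extendLeft (τ : Fin L → Fin L) (o s : Fin L → Bool)
    (y : {i : Fin L // o i = s i} → X) (i : Fin L) : X :=
  if h : o i = s i then y ⟨i, h⟩ else
    ∑ k : {k : Fin L // o k = s k}, jumpCoeff τ o s i k • y k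

theorem extendLeft_of_left (y : {i : Fin L // o i = s i} → X) {i : Fin L} (hi : o i = s i) :
    extendLeft τ o s y i = y ⟨i, hi⟩ :=
  dif_pos hi

theorem extendLeft_of_right (y : {i : Fin L // o i = s i} → X) {i : Fin L} (hi : o i ≠ s i) :
    extendLeft τ o s y i = ∑ k : {k : Fin L // o k = s k}, jumpCoeff τ o s i k • y k :=
  dif_neg hi

theorem sum_leftCoeff_smul (y : {i : Fin L // o i = s i} → X) (i : Fin L) :
    ∑ k : {k : Fin L // o k = s k}, leftCoeff τ o s i k • y k =
      ∑ j with o j ≠ s j, jumpCoeff τ o s i j • extendLeft τ o s y j := by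
  simp only [leftCoeff, Finset.sum_smul]
  rw [Finset.sum_comm]
  refine Finset.sum_congr rfl fun j hj => ?_
  simp only [extendLeft_of_right y ((Finset.mem_filter_univ j).1 hj), Finset.smul_sum, mul_smul]

theorem IsBlockWord.matrixSystem_leftMatrix_iff (hB : IsBlockWord w L lab τ o s)
    {y : {i : Fin L // o i = s i} → X} :
    matrixSystem (leftMatrix τ o s) X y ↔ ∀ i : {i : Fin L // o i = s i},
      extendLeft τ o s y (τ i) = -y i ∧
        y i = ∑ j with o j ≠ s j, jumpCoeff τ o s i j • extendLeft τ o s y j := by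
  have eq_partner_iff (i k : {i : Fin L // o i = s i}) :
      k.1 = τ i ↔ k = ⟨τ i, (hB.left_partner_iff i).2 i.2⟩ := by
    rw [Subtype.ext_iff]
  rw [matrixSystem, Sum.forall, ← forall_and]
  refine forall_congr' fun i => ?_
  simp only [leftMatrix, Matrix.of_apply, Sum.elim_inl, Sum.elim_inr, eq_partner_iff, add_smul,
    sub_smul, ite_smul, one_smul, zero_smul, Finset.sum_add_distrib, Finset.sum_sub_distrib,
    Finset.sum_ite_eq', Finset.mem_univ, if_true, sum_leftCoeff_smul]
  rw [extendLeft_of_left y ((hB.left_partner_iff i).2 i.2), sub_eq_zero, eq_neg_iff_add_eq_zero,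
    add_comm]

theorem IsBlockWord.extendLeft_restrict (hB : IsBlockWord w L lab τ o s) (hw : IsGaussWord w)
    (hs : IsSpherical w) {d : Fin L → X} (hd : jumpSystem τ o s X d) :
    extendLeft τ o s (fun k => d k) = d := by
  ext i
  by_cases hi : o i = s i
  · rw [extendLeft_of_left _ hi]
  · rw [extendLeft_of_right _ hi, ← hB.sum_jumpCoeff_of_right hw hs hd.1 hi, ← hd.2 i]

theorem IsBlockWord.matrixSystem_leftMatrix_restrict (hB : IsBlockWord w L lab τ o s)
    (hw : IsGaussWord w) (hs : IsSpherical w) {d : Fin L → X} (hd : jumpSystem τ o s X d) :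
    matrixSystem (leftMatrix τ o s) X fun k => d k := by
  rw [hB.matrixSystem_leftMatrix_iff, hB.extendLeft_restrict hw hs hd]
  exact fun i => ⟨hd.1 i, (hd.2 i).trans (hB.sum_jumpCoeff_of_left hw hs hd.1 i.2)⟩

theorem IsBlockWord.extendLeft_partner (hB : IsBlockWord w L lab τ o s)
    {y : {i : Fin L // o i = s i} → X} (hy : ∀ i, extendLeft τ o s y (τ i.1) = -y i) (i : Fin L) :
    extendLeft τ o s y (τ i) = -extendLeft τ o s y i := by
  by_cases hi : o i = s i
  · rw [extendLeft_of_left y hi]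
    exact hy ⟨i, hi⟩
  · rw [extendLeft_of_right y hi, extendLeft_of_right y (mt (hB.left_partner_iff i).1 hi),
      ← Finset.sum_neg_distrib]
    refine Finset.sum_congr rfl fun k _ => ?_
    rw [hB.jumpCoeff_partner_left (by simp [hi, k.2]), neg_smul]

theorem IsBlockWord.jumpSystem_extendLeft (hB : IsBlockWord w L lab τ o s) (hw : IsGaussWord w)
    (hs : IsSpherical w) {y : {i : Fin L // o i = s i} → X}
    (hy : matrixSystem (leftMatrix τ o s) X y) : jumpSystem τ o s X (extendLeft τ o s y) := by
  rw [hB.matrixSystem_leftMatrix_iff] at hy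
  have partner := hB.extendLeft_partner fun i => (hy i).1
  refine ⟨partner, fun i => ?_⟩
  by_cases hi : o i = s i
  · rw [hB.sum_jumpCoeff_of_left hw hs partner hi, extendLeft_of_left y hi]
    exact (hy ⟨i, hi⟩).2
  · rw [hB.sum_jumpCoeff_of_right hw hs partner hi, extendLeft_of_right y hi]
    exact Finset.sum_congr rfl fun k _ => by rw [extendLeft_of_left y k.2]

/-- The changes of color along the blocks are determined by those at the left. -/
noncomputable def IsBlockWord.leftIso (hB : IsBlockWord w L lab τ o s) (hw : IsGaussWord w)
    (hs : IsSpherical w) : SolutionIso (jumpSystem τ o s) (matrixSystem (leftMatrix τ o s)) where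
  toFun d k := d k
  invFun y := extendLeft τ o s y
  map_toFun _ _ := rfl
  map_invFun φ y := by
    ext i
    simp only [Function.comp_apply, extendLeft, apply_dite φ, map_sum, map_smul]
  toFun_mem := hB.matrixSystem_leftMatrix_restrict hw hs
  invFun_mem := hB.jumpSystem_extendLeft hw hs
  left_inv := hB.extendLeft_restrict hw hs
  right_inv _ := funext fun k => extendLeft_of_left _ k.2

end LeftBlocks

theorem KnotDiagram.IsMatched.one_add_T_notMem_alexanderIdeal {D D' : KnotDiagram}
    (hD : D.IsMatched) (h : D.knot = D'.knot) {m : ℕ} (hm : D'.alexanderIdeal m ≠ ⊤) :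
    (1 + LaurentPolynomial.T 1 : ℤ[T;T⁻¹]) ∉ D'.alexanderIdeal m := by
  obtain ⟨w, hrot, L, lab, τ, o, s, hB⟩ := hD.exists_isBlockWord
  obtain ⟨knotIso⟩ := nonempty_solutionIso_of_knot_eq h.symm
  obtain ⟨rotationIso⟩ := nonempty_solutionIso_of_isRotated hrot
  have leftIso := hB.leftIso (D.isGaussWord.of_isRotated hrot) (D.isSpherical.of_isRotated hrot)
  have ideal_eq := D'.alexanderIdeal_eq_minorIdeal
    (knotIso.trans (rotationIso.trans (hB.jumpIso.trans leftIso))) m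
  rw [ideal_eq] at hm ⊢
  exact mt (minorIdeal_eq_top_of_one_add_T_mem invert_leftMatrix) hm

section Pretzel

/-- A signed Gauss word of the pretzel knot with the parameters `3`, `-3`, `3`: each line passes
through one of the three columns of crossings. -/
def pretzelWord : List Letter :=
  [⟨0, true, true⟩, ⟨1, false, true⟩, ⟨2, true, true⟩,
   ⟨5, true, false⟩, ⟨4, false, false⟩, ⟨3, true, false⟩,
   ⟨6, true, true⟩, ⟨7, false, true⟩, ⟨8, true, true⟩,
   ⟨2, false, true⟩, ⟨1, true, true⟩, ⟨0, false, true⟩,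
   ⟨3, false, false⟩, ⟨4, true, false⟩, ⟨5, false, false⟩,
   ⟨8, false, true⟩, ⟨7, true, true⟩, ⟨6, false, true⟩]

theorem isGaussWord_pretzelWord : IsGaussWord pretzelWord where
  nodup := by decide
  mate_mem := by decide
  eq_or_eq_mate := by decide

instance (w : List Letter) (i : Fin w.length) : Decidable (FromRight w i) :=
  inferInstanceAs (Decidable (_ = _))

/-- The number of the face at the left of a dart. -/
def pretzelFace (d : Fin pretzelWord.length × Bool) : Fin 11 :=
  if d.2 then [0, 2, 0, 5, 0, 8, 3, 10, 3, 2, 3, 8, 6, 5, 6, 10, 6, 8].getD d.1 0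
  else [1, 3, 4, 6, 7, 6, 9, 6, 4, 0, 1, 0, 7, 0, 4, 3, 9, 3].getD d.1 0

/-- A dart with a given face at its left. -/
def pretzelDart (k : Fin 11) : Fin pretzelWord.length × Bool :=
  [((0 : Fin 18), true), (0, false), (1, true), (1, false), (2, false), (3, true), (3, false),
    (4, false), (5, true), (6, false), (7, true)].getD k (0, true)

/-- The other passage through the same crossing. -/
def pretzelPartner (i : Fin pretzelWord.length) : Fin pretzelWord.length :=
  [(11 : Fin 18), 10, 9, 14, 13, 12, 17, 16, 15, 2, 1, 0, 5, 4, 3, 8, 7, 6].getD i 0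

/-- The dart that follows on the boundary of the face at the left. -/
def pretzelNext : Fin pretzelWord.length × Bool → Fin pretzelWord.length × Bool
  | (i, true) =>
    if FromRight pretzelWord (finRotate _ i) then (pretzelPartner (finRotate _ i), true)
    else ((finRotate _).symm (pretzelPartner (finRotate _ i)), false)
  | (i, false) =>
    if FromRight pretzelWord i then ((finRotate _).symm (pretzelPartner i), false)
    else (pretzelPartner i, true)

theorem pretzelFace_eq_of_faceStep {d d' : Fin pretzelWord.length × Bool}
    (h : FaceStep pretzelWord d d') : pretzelFace d = pretzelFace d' := by
  cases h with
  | fwd_fwd i k hmeets hright => revert i k; decide +kernel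
  | fwd_bwd i k hmeets hright => revert i k; decide +kernel
  | bwd_bwd i k hmeets hright => revert i k; decide +kernel
  | bwd_fwd i k hmeets hright => revert i k; decide +kernel

theorem meets_pretzelPartner : ∀ i, Meets pretzelWord i (pretzelPartner i) := by decide +kernel

theorem faceStep_pretzelNext (d : Fin pretzelWord.length × Bool) :
    FaceStep pretzelWord d (pretzelNext d) := by
  rcases d with ⟨i, _ | _⟩
  · rw [pretzelNext]
    split_ifs with h
    · exact .bwd_bwd _ _ (by rw [Equiv.apply_symm_apply]; exact meets_pretzelPartner i) h
    · exact .bwd_fwd _ _ (meets_pretzelPartner i) h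
  · rw [pretzelNext]
    split_ifs with h
    · exact .fwd_fwd _ _ (meets_pretzelPartner _) h
    · exact .fwd_bwd _ _ (by rw [Equiv.apply_symm_apply]; exact meets_pretzelPartner _) h

theorem exists_iterate_pretzelNext :
    ∀ d, ∃ j : Fin 7, pretzelNext^[j] d = pretzelDart (pretzelFace d) := by
  decide +kernel

theorem faceAt_iterate_pretzelNext (j : ℕ) (d : Fin pretzelWord.length × Bool) :
    faceAt (pretzelNext^[j] d) = faceAt d := by
  induction j generalizing d with
  | zero => rfl
  | succ j ih =>
    rw [Function.iterate_succ_apply, ih]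
    exact (Quot.sound (faceStep_pretzelNext d)).symm

theorem faceAt_pretzelDart_pretzelFace (d : Fin pretzelWord.length × Bool) :
    faceAt (pretzelDart (pretzelFace d)) = faceAt d := by
  obtain ⟨j, hj⟩ := exists_iterate_pretzelNext d
  rw [← hj, faceAt_iterate_pretzelNext]

theorem pretzelFace_pretzelDart : ∀ k, pretzelFace (pretzelDart k) = k := by decide

/-- The faces of the pretzel knot are numbered by `Fin 11`. -/
def pretzelFaceEquiv : Face pretzelWord ≃ Fin 11 where
  toFun := Quot.lift pretzelFace fun _ _ => pretzelFace_eq_of_faceStep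
  invFun k := faceAt (pretzelDart k)
  left_inv := Quot.ind faceAt_pretzelDart_pretzelFace
  right_inv := pretzelFace_pretzelDart

theorem isSpherical_pretzelWord : IsSpherical pretzelWord := by
  right
  rw [Nat.card_congr pretzelFaceEquiv, Nat.card_fin]
  rfl

/-- The pretzel knot with the parameters `3`, `-3`, `3`. -/
def pretzelDiagram : KnotDiagram where
  word := pretzelWord
  isGaussWord := isGaussWord_pretzelWord
  isSpherical := isSpherical_pretzelWord

-- The crossings 1, 4 and 7 are those in the middle of the columns. The colors of their upper
-- strands are `a`, `b` and `e`; the premises express the other colors `c₂`, `c₃`, `c₈` by these.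
theorem pretzel_relations_iff {R Y : Type*} [CommRing R] [AddCommGroup Y] [Module R Y] {t t' : R}
    (h : t * t' = 1) {a b e c₂ c₃ c₈ : Y} (h₂ : c₂ = (1 - t) • a)
    (h₃ : c₃ = t' • c₂ + (1 - t') • b) (h₈ : c₈ = t • c₃ + (1 - t) • e) :
    (a = t • c₈ + (1 - t) • c₂ ∧ b = t' • t • a + (1 - t') • c₃ ∧
      e = t • (t' • b + (1 - t') • c₂) + (1 - t) • c₈ ∧ t • e + (1 - t) • c₃ = 0) ↔
      (t - 1) • (b - e) - a = 0 ∧ (2 - t') • (a - b) = 0 ∧ (2 - t) • (b - e) = 0 := by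
  have expand_a : t • c₈ + (1 - t) • c₂ = a + t • ((t - 1) • (b - e) - a) := by
    subst h₂ h₃ h₈
    match_scalars <;> grind
  have expand_b : t' • t • a + (1 - t') • c₃ = b + t' • (2 - t') • (a - b) := by
    subst h₂ h₃
    match_scalars <;> grind
  have expand_e : t • (t' • b + (1 - t') • c₂) + (1 - t) • c₈ = e + t • (2 - t) • (b - e) := by
    subst h₂ h₃ h₈
    match_scalars <;> grind
  have expand_last : t • e + (1 - t) • c₃ =
      -(t • ((t - 1) • (b - e) - a) + t • (2 - t) • (b - e) + (2 - t') • (a - b)) := by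
    subst h₂ h₃
    match_scalars <;> grind
  have ht : IsUnit t := IsUnit.of_mul_eq_one _ h
  have ht' : IsUnit t' := IsUnit.of_mul_eq_one_right _ h
  rw [expand_a, expand_b, expand_e, expand_last, left_eq_add, left_eq_add, left_eq_add,
    ht.smul_eq_zero, ht'.smul_eq_zero, ht.smul_eq_zero]
  refine ⟨fun ⟨ha, hb, he, _⟩ => ⟨ha, hb, he⟩, fun ⟨ha, hb, he⟩ => ⟨ha, hb, he, ?_⟩⟩
  rw [ha, hb, he, smul_zero, add_zero, add_zero, neg_zero]

variable {X : Type} [AddCommGroup X] [Module ℤ[T;T⁻¹] X]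

/-- The colors of the upper strands of the pretzel knot, computed from those in the middle of the
three columns. -/
noncomputable def pretzelColoring (a b e : X) (k : ℕ) : X :=
  let c₂ := (1 - tPow true) • a
  let c₃ := tPow false • c₂ + (1 - tPow false) • b
  let c₈ := tPow true • c₃ + (1 - tPow true) • e
  [0, a, c₂, c₃, b, c₂, c₃, e, c₈].getD k 0

theorem notMem_labels_pretzelWord_iff {a : ℕ} : a ∉ pretzelWord.map Letter.label ↔ 9 ≤ a := by
  simp only [pretzelWord, List.map_cons, List.map_nil, List.mem_cons, List.not_mem_nil, or_false]
  omega

theorem runs_cons_over_label {c : ℕ → X} {a : ℕ} {s : Bool} {w : List Letter} {x y : X} :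
    Runs c (⟨a, true, s⟩ :: w) x y ↔ c a = x ∧ Runs c w (c a) y := by
  rw [runs_cons_over]
  exact and_congr_right fun h => by rw [h]

theorem eq_pretzelColoring {c : ℕ → X} (hc : coloringSystem pretzelWord X c) :
    c = pretzelColoring (c 1) (c 4) (c 7) := by
  obtain ⟨eq_zero, hruns⟩ := hc
  simp only [pretzelWord, runs_cons_over_label, runs_cons_under, runs_nil] at hruns
  obtain ⟨h0, h2, h5, h3, h6, h8, -⟩ := hruns
  rw [h0, smul_zero, zero_add] at h2
  ext k
  match k with
  | 0 => exact h0
  | 1 | 4 | 7 => rfl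
  | 2 => exact h2
  | 3 => rw [h3, h5, h2]; rfl
  | 5 => rw [h5, h2]; rfl
  | 6 => rw [h6, h3, h5, h2]; rfl
  | 8 => rw [h8, h6, h3, h5, h2]; rfl
  | k + 9 => exact eq_zero _ (notMem_labels_pretzelWord_iff.2 (by omega))

theorem coloringSystem_pretzelColoring_iff {a b e : X} :
    coloringSystem pretzelWord X (pretzelColoring a b e) ↔ (tPow true - 1) • (b - e) - a = 0 ∧
      (2 - tPow false) • (a - b) = 0 ∧ (2 - tPow true) • (b - e) = 0 := by
  rw [← Bool.not_true, ← pretzel_relations_iff (tPow_mul_tPow_not true) rfl rfl rfl]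
  have eq_zero : ∀ k ∉ pretzelWord.map Letter.label, pretzelColoring a b e k = 0 := fun k hk =>
    List.getD_eq_default _ _ (notMem_labels_pretzelWord_iff.1 hk)
  rw [coloringSystem, and_iff_right eq_zero]
  simp only [pretzelWord, runs_cons_over_label, runs_cons_under, runs_nil]
  simp [pretzelColoring]

theorem map_comp_pretzelColoring {Y : Type} [AddCommGroup Y] [Module ℤ[T;T⁻¹] Y]
    (φ : X →ₗ[ℤ[T;T⁻¹]] Y) (a b e : X) :
    φ ∘ pretzelColoring a b e = pretzelColoring (φ a) (φ b) (φ e) := by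
  ext k
  rw [Function.comp_apply, pretzelColoring, ← List.getD_map (f := φ)]
  simp only [List.map_cons, List.map_nil, map_add, map_smul, map_zero, pretzelColoring]

/-- A presentation matrix of the Alexander module of the pretzel knot. -/
noncomputable def pretzelMatrix : Matrix (Fin 2) (Fin 2) ℤ[T;T⁻¹] :=
  Matrix.diagonal ![2 - tPow false, 2 - tPow true]

theorem matrixSystem_pretzelMatrix_iff {y : Fin 2 → X} :
    matrixSystem pretzelMatrix X y ↔ (2 - tPow false) • y 0 = 0 ∧ (2 - tPow true) • y 1 = 0 := by
  simp [matrixSystem, pretzelMatrix, Fin.forall_fin_two]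

/-- The colorings of the pretzel knot, parametrized by the differences of the colors in the middle
of adjacent columns. -/
noncomputable def pretzelIso :
    SolutionIso (coloringSystem pretzelWord) (matrixSystem pretzelMatrix) where
  toFun c := ![c 1 - c 4, c 4 - c 7]
  invFun y :=
    let a := (tPow true - 1) • y 1
    pretzelColoring a (a - y 0) (a - y 0 - y 1)
  map_toFun φ c := by
    ext i
    fin_cases i <;> simp
  map_invFun φ y := by
    simp only [map_comp_pretzelColoring, map_sub, map_smul, Function.comp_apply]
  toFun_mem {X _ _ c} hc := by
    rw [eq_pretzelColoring hc, coloringSystem_pretzelColoring_iff] at hc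
    exact matrixSystem_pretzelMatrix_iff.2 hc.2
  invFun_mem {X _ _ y} hy := by
    rw [coloringSystem_pretzelColoring_iff, sub_sub_cancel, sub_sub_cancel]
    exact ⟨sub_self _, matrixSystem_pretzelMatrix_iff.1 hy⟩
  left_inv {X _ _ c} hc := by
    have relations := hc
    rw [eq_pretzelColoring hc, coloringSystem_pretzelColoring_iff] at relations
    have color_one : (tPow true - 1) • (c 4 - c 7) = c 1 := sub_eq_zero.1 relations.1
    simp [color_one, ← eq_pretzelColoring hc]
  right_inv {X _ _ y} _ := by
    ext i
    fin_cases i <;> simp [pretzelColoring]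

theorem alexanderIdeal_two_pretzelDiagram :
    pretzelDiagram.alexanderIdeal 2 = minorIdeal pretzelMatrix 1 :=
  pretzelDiagram.alexanderIdeal_eq_minorIdeal pretzelIso 2

theorem apply_mem_minorIdeal_one {R ι κ : Type*} [CommRing R] (A : Matrix ι κ R) (i : ι) (j : κ) :
    A i j ∈ minorIdeal A 1 := by
  simpa using det_submatrix_mem_minorIdeal A (fun _ : Fin 1 => i) (fun _ => j)

theorem one_add_T_mem_alexanderIdeal_pretzelDiagram :
    1 + LaurentPolynomial.T 1 ∈ pretzelDiagram.alexanderIdeal 2 := by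
  rw [alexanderIdeal_two_pretzelDiagram]
  have mem₀ : 2 - tPow false ∈ minorIdeal pretzelMatrix 1 :=
    apply_mem_minorIdeal_one pretzelMatrix 0 0
  have mem₁ : 2 - tPow true ∈ minorIdeal pretzelMatrix 1 :=
    apply_mem_minorIdeal_one pretzelMatrix 1 1
  have combination : 1 + LaurentPolynomial.T 1 =
      tPow true * (2 - tPow false) + (2 - tPow true) := by
    have mul_eq_one := tPow_mul_tPow_not true
    rw [Bool.not_true] at mul_eq_one
    change 1 + tPow true = _
    linear_combination mul_eq_one
  rw [combination]
  exact Ideal.add_mem _ (Ideal.mul_mem_left _ _ mem₀) mem₁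

theorem alexanderIdeal_pretzelDiagram_ne_top : pretzelDiagram.alexanderIdeal 2 ≠ ⊤ := by
  rw [alexanderIdeal_two_pretzelDiagram]
  let ψ : ℤ[T;T⁻¹] →+* ZMod 3 := LaurentPolynomial.eval₂ (Int.castRingHom (ZMod 3)) (-1)
  have map_tPow (s) : ψ (tPow s) = -1 := by cases s <;> simp [ψ, tPow]
  have map_two : ψ 2 + 1 = 0 := by
    rw [map_ofNat]
    decide
  have map_pretzelMatrix (i j) : ψ (pretzelMatrix i j) = 0 := by
    fin_cases i <;> fin_cases j <;> simp [pretzelMatrix, map_tPow, map_two]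
  refine ne_top_of_le_ne_top (RingHom.ker_ne_top ψ) (minorIdeal_le_iff.2 fun p q => ?_)
  rw [RingHom.mem_ker, Matrix.det_fin_one, Matrix.submatrix_apply, map_pretzelMatrix]

theorem not_isBipartite_pretzelDiagram_knot : ¬ pretzelDiagram.knot.IsBipartite := by
  rintro ⟨D, h, hD⟩
  exact hD.one_add_T_notMem_alexanderIdeal h alexanderIdeal_pretzelDiagram_ne_top
    one_add_T_mem_alexanderIdeal_pretzelDiagram

end Pretzel

end BipartiteKnots

theorem mainTheorem1 :
    (∀ K : BipartiteKnots.Knot, K.IsBipartite →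
      ∀ D : BipartiteKnots.KnotDiagram, D.knot = K →
        ∀ m : ℕ, D.alexanderIdeal m ≠ ⊤ →
          (1 + LaurentPolynomial.T 1 : LaurentPolynomial ℤ) ∉ D.alexanderIdeal m) ∧
    (∃ K : BipartiteKnots.Knot, ¬ K.IsBipartite) := by
  refine ⟨?_, _, BipartiteKnots.not_isBipartite_pretzelDiagram_knot⟩
  rintro K ⟨D₀, h₀, hD₀⟩ D hD m hm
  exact hD₀.one_add_T_notMem_alexanderIdeal (h₀.trans hD.symm) hm
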